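/- **Setting.** Let $\Omega\subset\mathbb R^3$ be a bounded, connected open set containing the origin, with boundary $\Gamma$ of class $C^2$, split into disjoint measurable parts $\Gamma=\Gamma_b\cup\Gamma_t\cup\Gamma_v$; put $\Gamma_{bt}=\Gamma_b\cup\Gamma_t$, $T>0$, $\mathcal Q=\Omega\times(0,T)$, $\Lambda=\Gamma_{bt}\times(0,T)$. Write $(\cdot,\cdot)$ for the $L^2(\Omega)$ product, $L^p(X)$ for $L^p(0,T;X)$, and $H=\{u\in L^2(\Omega)^3:\operatorname{div}u=0,\ u\cdot n=0\text{ on }\Gamma\}$, $H_\theta=\{\psi\in H^1(\Omega):\psi=0\text{ on }\Gamma_{bt}\}$, $H_v=\{w\in H^1(\Omega)^3:\operatorname{div}w=0,\ w=0\text{ on }\Gamma_{bt},\ w\cdot n=0\text{ on }\Gamma_v\}$. *Phase diagram.* Let $\theta_E<\theta_F$ and let $\gamma_\ell,\gamma_s:[\theta_E,\theta_F]\to\mathbb R$ be continuous and strictly decreasing with $\gamma_\ell(\theta_F)=\gamma_s(\theta_F)=0$ and $\gamma_s<\gamma_\ell$ on $[\theta_E,\theta_F)$; put $c_E=\gamma_\ell(\theta_E)$,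 $c_A=\gamma_s(\theta_E)$. In the $(c,\theta)$-plane let $\Theta_l=\{0<c<c_E,\ \theta>\gamma_\ell^{-1}(c)\}$, $\Theta_m=\{\theta_E<\theta<\theta_F,\ \gamma_s(\theta)<c<\gamma_\ell(\theta)\}$, $\Theta_s=\{0<c<c_A,\ \theta<\gamma_s^{-1}(c)\}$, $\Theta_\pm=\{\pm c>0\}\setminus\overline{\Theta_l\cup\Theta_s\cup\Theta_m}$, and $\Theta_{ml}=\Theta_m\cup\{c=\gamma_\ell(\theta),\ \theta_E<\theta<\theta_F\}\cup\Theta_l$. Let $c_l(c,\theta)$ be $c$ on $\Theta_l$, $\gamma_\ell(\gamma_s^{-1}(c))$ on $\Theta_s$, $0$ on $\overline{\Theta_-}$, $c_E$ on $\overline{\Theta_+}$, and $\gamma_\ell(\theta)$ on the rest of $\overline{\Theta_m}$; assume $c_l\in W^{1,\infty}(\mathbb R^2)$. Let $f_s$ be $\frac{\gamma_\ell(\theta)-c}{\gamma_\ell(\theta)-\gamma_s(\theta)}$ on $\Theta_m$, $1$ on $\overline{\Theta_s\cup\Theta_+}$ and $0$ elsewhere. *Coefficients and data.* Let $\eta,\kappa,C_0>0$,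 let $\nu,\rho,C_p,\alpha,\beta,\theta_r,c_r,g\in\mathbb R$, and $F_i=C_0f_s^2/(1-f_s)^3$, $\mathbf F_e(c,\theta)=\rho\,(0,0,-g)^t\,(\alpha(\theta-\theta_r)+\beta(c_l(c,\theta)-c_r))$. Let $0\le c_g\le\gamma_\ell(\theta_E)|\Omega|$. Let $\theta_\delta\in H^1(0,T;L^\infty(\Gamma_{bt}))$ be the trace on $\Gamma_{bt}$ of a function, also called $\theta_\delta$, in $H^1(0,T;H^1(\Omega))$ with $\theta_\delta(\cdot,0)=\theta_\delta(\cdot,T)$ in $\Omega$. *Weak reproductive solutions.* $(c,\theta,v)$ is a weak reproductive solution, with $c_0,\theta_0\in L^2(\Omega)$ and $v_0\in H$, if * $c,\theta\in L^2(H^1(\Omega))\cap L^\infty(L^2(\Omega))$, $v\in L^2(H_v)\cap L^\infty(H)$; * $c(0)=c(T)=c_0$, $\theta(0)=\theta(T)=\theta_0$, $v(0)=v(T)=v_0$ a.e. in $\Omega$, where $c,\theta$ are taken as their weakly continuous representatives $[0,T]\to L^2(\Omega)$ and the end values of $v$ are weak $L^2$ limits; * for a.e. $t\in(0,T)$: $\int_\Omega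 c(x,t)\,dx=c_g$ and $\theta(\cdot,t)-\theta_\delta(\cdot,t)\in H_\theta$; * $v=0$ a.e. on $\{(x,t)\in\mathcal Q:(c,\theta)(x,t)\in\Theta_s\}$; * in the sense of distributions on $(0,T)$, $$\tfrac{d}{dt}(c,\varphi)+\eta(\nabla c,\nabla\varphi)+(v\cdot\nabla c_l(c,\theta),\varphi)=0\quad\forall\varphi\in H^1(\Omega),$$ $$\tfrac{d}{dt}(\theta,\psi)+\kappa(\nabla\theta,\nabla\psi)+\rho C_p(v\cdot\nabla\theta,\psi)=0\quad\forall\psi\in H_\theta,$$ $$\tfrac{d}{dt}(v,w)+\nu(\nabla v,\nabla w)+\rho((v\cdot\nabla)v,w)+(F_i(c,\theta)v,w)=(\mathbf F_e(c,\theta),w)$$ for all $w\in H_v$ with support in the mixture–liquid region; that is, the last equation is tested with $w(x)\zeta(t)$, $w\in H_v$ vanishing outside a compact $K\subset\Omega$, $\zeta\in C_c^\infty(0,T)$, such that $(c,\theta)$ takes a.e. on $K\times\operatorname{supp}\zeta$ values in a compact subset of $\Theta_{ml}$. No bound on $c$ is assumed. **Proposition 3.5.** Every weak reproductive solution $(c,\theta,v)$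 satisfies $$0\le c(x,t)\le\gamma_\ell(\theta_E)\quad\text{and}\quad\theta_\delta^{\inf}\le\theta(x,t)\le\theta_\delta^{\sup}\qquad\text{for a.e. }(x,t)\in\mathcal Q,$$ where $\theta_\delta^{\inf}=\min\{\inf_\Omega\theta_0,\ \inf_\Lambda\theta_\delta\}$ and $\theta_\delta^{\sup}=\max\{\sup_\Omega\theta_0,\ \sup_\Lambda\theta_\delta\}$ (essential infima and suprema, with values in $[-\infty,\infty]$). -/

import Mathlib

open MeasureTheory Set Filter Topology
open scoped ENNReal ContDiff

namespace Solidification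

noncomputable section

/-- Physical space `ℝ³` with the Euclidean norm. -/
abbrev E3 : Type := EuclideanSpace ℝ (Fin 3)

/-! ### Sobolev functions -/

/-- `g` is the weak (distributional) derivative of `u` on the open set `Ω`. -/
def HasWeakFDeriv {V : Type*} [NormedAddCommGroup V] [NormedSpace ℝ V] [MeasureSpace V]
    (Ω : Set V) (u : V → ℝ) (g : V → V →L[ℝ] ℝ) : Prop :=
  ∀ φ : V → ℝ, ContDiff ℝ ∞ φ → HasCompactSupport φ → tsupport φ ⊆ Ω →
    ∀ y : V, ∫ x in Ω, u x * fderiv ℝ φ x y = -∫ x in Ω, φ x * g x y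

/-- The space `W^{1,∞}(V)`. -/
def MemW1Infty {V : Type*} [NormedAddCommGroup V] [NormedSpace ℝ V] [MeasureSpace V]
    (u : V → ℝ) : Prop :=
  MemLp u ∞ volume ∧ ∃ g : V → V →L[ℝ] ℝ, MemLp g ∞ volume ∧ HasWeakFDeriv univ u g

/-- `u ∈ H¹(Ω)` with weak gradient `Du`. -/
structure IsH1 (Ω : Set E3) (u : E3 → ℝ) (Du : E3 → E3) : Prop where
  memLp : MemLp u 2 (volume.restrict Ω)
  memLp_grad : MemLp Du 2 (volume.restrict Ω)
  weak : HasWeakFDeriv Ω u (fun x => innerSL ℝ (Du x))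

/-- Surface measure: the two-dimensional Hausdorff measure (up to a constant factor, which
plays no role here). -/
def surf : Measure E3 := Measure.hausdorffMeasure 2

/-- `τ ∈ L²(∂Ω)` is the boundary trace of `u ∈ H¹(Ω)` (with weak gradient `Du`): the pair
`(u, τ)` is the limit in `H¹(Ω) × L²(∂Ω)` of pairs `(φₙ|_Ω, φₙ|_{∂Ω})` with `φₙ ∈ C¹(ℝ³)`. -/
def HasTrace (Ω : Set E3) (u : E3 → ℝ) (Du : E3 → E3) (τ : E3 → ℝ) : Prop :=
  IsH1 Ω u Du ∧ MemLp τ 2 (surf.restrict (frontier Ω)) ∧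
  ∃ φ : ℕ → E3 → ℝ, (∀ n, ContDiff ℝ 1 (φ n)) ∧
    Tendsto (fun n => eLpNorm (fun x => φ n x - u x) 2 (volume.restrict Ω)) atTop (𝓝 0) ∧
    Tendsto (fun n => eLpNorm (fun x => gradient (φ n) x - Du x) 2 (volume.restrict Ω))
      atTop (𝓝 0) ∧
    Tendsto (fun n => eLpNorm (fun x => φ n x - τ x) 2 (surf.restrict (frontier Ω)))
      atTop (𝓝 0)

/-! ### Domains with `C²` boundary -/

/-- `f` is a `C²` defining function of `Ω` on the neighbourhood `U` of the boundary point `x₀`. -/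
structure IsLocalDefiningFunction (Ω : Set E3) (x₀ : E3) (U : Set E3) (f : E3 → ℝ) : Prop where
  isOpen : IsOpen U
  mem : x₀ ∈ U
  contDiffOn : ContDiffOn ℝ 2 f U
  apply_eq_zero : f x₀ = 0
  gradient_ne_zero : gradient f x₀ ≠ 0
  inter_eq : U ∩ Ω = {x ∈ U | f x < 0}

/-- The boundary of `Ω` is of class `C²` (and `Ω` lies locally on one side of it). -/
def HasC2Boundary (Ω : Set E3) : Prop :=
  ∀ x₀ ∈ frontier Ω, ∃ U f, IsLocalDefiningFunction Ω x₀ U f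

/-- `n` is the outward unit normal to `∂Ω` at the boundary point `x`. -/
def IsOuterUnitNormal (Ω : Set E3) (x n : E3) : Prop :=
  ∃ U f, IsLocalDefiningFunction Ω x U f ∧ n = ‖gradient f x‖⁻¹ • gradient f x

/-! ### The function spaces of the problem -/

/-- `ψ ∈ H_θ`: `ψ ∈ H¹(Ω)` (with weak gradient `Dψ`) and `ψ = 0` on `Γbt`. -/
def MemHtheta (Ω Γbt : Set E3) (ψ : E3 → ℝ) (Dψ : E3 → E3) : Prop :=
  ∃ τ : E3 → ℝ, HasTrace Ω ψ Dψ τ ∧ ∀ᵐ x ∂surf.restrict Γbt, τ x = 0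

/-- `u ∈ H`: `u ∈ L²(Ω)³`, `div u = 0` in `Ω`, `u · n = 0` on `∂Ω`. For `u ∈ L²` with `div u = 0`
the normal trace is the functional `⟨u · n, φ⟩ = ∫_Ω u · ∇φ` on `H¹(Ω)`. -/
structure MemH (Ω : Set E3) (u : E3 → E3) : Prop where
  memLp : MemLp u 2 (volume.restrict Ω)
  div_eq_zero : ∀ φ : E3 → ℝ, ContDiff ℝ ∞ φ → HasCompactSupport φ → tsupport φ ⊆ Ω →
    ∫ x in Ω, fderiv ℝ φ x (u x) = 0
  normal_eq_zero : ∀ φ Dφ, IsH1 Ω φ Dφ → ∫ x in Ω, inner ℝ (u x) (Dφ x) = 0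

/-- `w ∈ H_v`: `w ∈ H¹(Ω)³` (where `Dw i` is the weak gradient of the `i`-th component),
`div w = 0` in `Ω`, `w = 0` on `Γbt` and `w · n = 0` on `Γv`. -/
structure MemHv (Ω Γbt Γv : Set E3) (w : E3 → E3) (Dw : Fin 3 → E3 → E3) : Prop where
  isH1 : ∀ i, IsH1 Ω (fun x => w x i) (Dw i)
  div_eq_zero : ∀ᵐ x ∂volume.restrict Ω, ∑ i, Dw i x i = 0
  boundary : ∃ τ : E3 → E3, (∀ i, HasTrace Ω (fun x => w x i) (Dw i) (fun x => τ x i)) ∧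
    (∀ᵐ x ∂surf.restrict Γbt, τ x = 0) ∧
    ∀ᵐ x ∂surf.restrict Γv, ∀ n, IsOuterUnitNormal Ω x n → inner ℝ (τ x) n = 0

/-- `b ∈ H¹(0,T;X)`, represented by its continuous representative on `[0,T]`. -/
def MemBochnerH1 {X : Type*} [NormedAddCommGroup X] [NormedSpace ℝ X] (T : ℝ) (b : ℝ → X) :
    Prop :=
  ∃ b' : ℝ → X, MemLp b' 2 (volume.restrict (Ioo 0 T)) ∧
    ∀ t ∈ Icc 0 T, b t = b 0 + ∫ s in (0 : ℝ)..t, b' s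

/-- Lebesgue measure on the space-time cylinder; points are written `(t, x)`. -/
def cylinder (Ω : Set E3) (T : ℝ) : Measure (ℝ × E3) :=
  (volume.restrict (Ioo 0 T)).prod (volume.restrict Ω)

/-- The bound in `L^∞(0,T;L²(Ω))`. -/
def BddInL2 {F : Type*} [NormedAddCommGroup F] (Ω : Set E3) (T : ℝ) (u : ℝ → E3 → F) : Prop :=
  ∃ M : ℝ, ∀ᵐ t ∂volume.restrict (Ioo 0 T),
    eLpNorm (u t) 2 (volume.restrict Ω) ≤ ENNReal.ofReal M

/-- `u ∈ L²(0,T;H¹(Ω))` with spatial weak gradient `Du`. -/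
structure MemL2H1 (Ω : Set E3) (T : ℝ) (u : ℝ → E3 → ℝ) (Du : ℝ → E3 → E3) : Prop where
  memLp : MemLp (fun p : ℝ × E3 => u p.1 p.2) 2 (cylinder Ω T)
  memLp_grad : MemLp (fun p : ℝ × E3 => Du p.1 p.2) 2 (cylinder Ω T)
  isH1 : ∀ᵐ t ∂volume.restrict (Ioo 0 T), IsH1 Ω (u t) (Du t)

/-- `u` is the representative that is weakly continuous from `[0,T]` to `L²(Ω)`; this is what
gives a meaning to the values of `u` at the times `0` and `T`. -/
def WeaklyContinuousL2 (Ω : Set E3) (T : ℝ) (u : ℝ → E3 → ℝ) : Prop :=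
  (∀ t ∈ Icc 0 T, MemLp (u t) 2 (volume.restrict Ω)) ∧
  ∀ φ : E3 → ℝ, MemLp φ 2 (volume.restrict Ω) →
    ContinuousOn (fun t => ∫ x in Ω, u t x * φ x) (Icc 0 T)

/-- `v(t) ⇀ a` weakly in `L²(Ω)³` along the filter `l` of times (up to null sets of times). -/
def WeakTimeLimit (Ω : Set E3) (v : ℝ → E3 → E3) (l : Filter ℝ) (a : E3 → E3) : Prop :=
  ∀ φ : E3 → E3, MemLp φ 2 (volume.restrict Ω) →
    Tendsto (fun t => ∫ x in Ω, inner ℝ (v t x) (φ x)) (l ⊓ ae volume)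
      (𝓝 (∫ x in Ω, inner ℝ (a x) (φ x)))

/-- `ζ` is a test function on `(0,T)`. -/
def IsTimeTest (T : ℝ) (ζ : ℝ → ℝ) : Prop :=
  ContDiff ℝ ∞ ζ ∧ HasCompactSupport ζ ∧ tsupport ζ ⊆ Ioo 0 T

/-! ### The phase diagram -/

/-- Eutectic and fusion temperatures, liquidus `γl` and solidus `γs` of a binary alloy. -/
structure PhaseDiagram where
  θE : ℝ
  θF : ℝ
  γl : ℝ → ℝ
  γs : ℝ → ℝ
  θE_lt_θF : θE < θF
  continuousOn_γl : ContinuousOn γl (Icc θE θF)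
  continuousOn_γs : ContinuousOn γs (Icc θE θF)
  strictAntiOn_γl : StrictAntiOn γl (Icc θE θF)
  strictAntiOn_γs : StrictAntiOn γs (Icc θE θF)
  γl_θF : γl θF = 0
  γs_θF : γs θF = 0
  γs_lt_γl : ∀ θ ∈ Ico θE θF, γs θ < γl θ

namespace PhaseDiagram

variable (P : PhaseDiagram)

def cE : ℝ := P.γl P.θE

def cA : ℝ := P.γs P.θE

/-- The inverse of the liquidus curve, `[0, cE] → [θE, θF]`. -/
def γlInv : ℝ → ℝ := Function.invFunOn P.γl (Icc P.θE P.θF)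

/-- The inverse of the solidus curve, `[0, cA] → [θE, θF]`. -/
def γsInv : ℝ → ℝ := Function.invFunOn P.γs (Icc P.θE P.θF)

/-- Liquid zone, in the `(c, θ)` plane. -/
def zoneL : Set (ℝ × ℝ) := {z | 0 < z.1 ∧ z.1 < P.cE ∧ P.γlInv z.1 < z.2}

/-- Mixture zone. -/
def zoneM : Set (ℝ × ℝ) :=
  {z | P.θE < z.2 ∧ z.2 < P.θF ∧ P.γs z.2 < z.1 ∧ z.1 < P.γl z.2}

/-- Solid zone. -/
def zoneS : Set (ℝ × ℝ) := {z | 0 < z.1 ∧ z.1 < P.cA ∧ z.2 < P.γsInv z.1}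

def zonePlus : Set (ℝ × ℝ) := {z | 0 < z.1} \ closure (P.zoneL ∪ P.zoneS ∪ P.zoneM)

def zoneMinus : Set (ℝ × ℝ) := {z | z.1 < 0} \ closure (P.zoneL ∪ P.zoneS ∪ P.zoneM)

/-- Mixture and liquid zones together with the interface between them. -/
def zoneML : Set (ℝ × ℝ) :=
  P.zoneM ∪ {z | P.θE < z.2 ∧ z.2 < P.θF ∧ z.1 = P.γl z.2} ∪ P.zoneL

open Classical in
/-- Concentration of solute in the liquid phase, extended to the whole plane. The last case
covers the points of the closed mixture zone that are not boundary points of `zoneMinus` or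
`zonePlus`. -/
def cl (z : ℝ × ℝ) : ℝ :=
  if z ∈ P.zoneL then z.1
  else if z ∈ P.zoneS then P.γl (P.γsInv z.1)
  else if z ∈ closure P.zoneMinus then 0
  else if z ∈ closure P.zonePlus then P.cE
  else P.γl z.2

open Classical in
/-- Solid fraction, extended to the whole plane. -/
def fs (z : ℝ × ℝ) : ℝ :=
  if z ∈ P.zoneM then (P.γl z.2 - z.1) / ((P.γl z.2 - z.1) + (z.1 - P.γs z.2))
  else if z ∈ closure (P.zoneS ∪ P.zonePlus) then 1
  else 0

end PhaseDiagram

/-! ### The data of the problem -/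

/-- The data of the solidification problem, with the standing hypotheses on them. -/
structure Data where
  /-- the mould and the parts (bottom, top, vertical) of its boundary -/
  Ω : Set E3
  Γb : Set E3
  Γt : Set E3
  Γv : Set E3
  isOpen : IsOpen Ω
  isConnected : IsConnected Ω
  zero_mem : (0 : E3) ∈ Ω
  isBounded : Bornology.IsBounded Ω
  boundary_C2 : HasC2Boundary Ω
  measurableSet_Γb : MeasurableSet Γb
  measurableSet_Γt : MeasurableSet Γt
  measurableSet_Γv : MeasurableSet Γv
  union_eq : Γb ∪ Γt ∪ Γv = frontier Ω
  disjoint_bt : Disjoint Γb Γt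
  disjoint_bv : Disjoint Γb Γv
  disjoint_tv : Disjoint Γt Γv
  /-- the final time -/
  T : ℝ
  T_pos : 0 < T
  /-- the phase diagram; the liquid concentration is in `W^{1,∞}(ℝ²)` -/
  P : PhaseDiagram
  cl_mem : MemW1Infty P.cl
  /-- physical constants -/
  η : ℝ
  κ : ℝ
  ν : ℝ
  ρ : ℝ
  Cp : ℝ
  C0 : ℝ
  α : ℝ
  β : ℝ
  θr : ℝ
  cr : ℝ
  grav : ℝ
  η_pos : 0 < η
  κ_pos : 0 < κ
  C0_pos : 0 < C0
  /-- total quantity of solute, with the compatibility relation -/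
  cg : ℝ
  cg_nonneg : 0 ≤ cg
  cg_le : cg ≤ P.γl P.θE * volume.real Ω
  /-- temperature prescribed on `Γb ∪ Γt`, in `H¹(0,T;L^∞(Γb ∪ Γt))` -/
  θδ : ℝ → Lp ℝ ∞ (surf.restrict (Γb ∪ Γt))
  θδ_mem : MemBochnerH1 T θδ
  /-- its extension to `Ω` in `H¹(0,T;H¹(Ω))`, and the spatial gradient of the extension -/
  ext : ℝ → Lp ℝ 2 (volume.restrict Ω)
  Dext : ℝ → Lp E3 2 (volume.restrict Ω)
  ext_isH1 : ∀ t ∈ Icc 0 T, IsH1 Ω (ext t) (Dext t)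
  ext_mem : MemBochnerH1 T ext
  Dext_mem : MemBochnerH1 T Dext
  ext_trace : ∀ᵐ t ∂volume.restrict (Ioo 0 T), ∃ τ : E3 → ℝ,
    HasTrace Ω (ext t) (Dext t) τ ∧ ∀ᵐ x ∂surf.restrict (Γb ∪ Γt), τ x = θδ t x
  ext_periodic : ext 0 = ext T

namespace Data

variable (D : Data)

def Γbt : Set E3 := D.Γb ∪ D.Γt

/-- The measure of the cylinder `Q`. -/
def Q : Measure (ℝ × E3) := cylinder D.Ω D.T

/-- Carman–Kozeny term. -/
def Fi (z : ℝ × ℝ) : ℝ := D.C0 * (D.P.fs z ^ 2 / (1 - D.P.fs z) ^ 3)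

/-- External force (Boussinesq approximation), with gravity `(0, 0, -grav)`. -/
def Fe (z : ℝ × ℝ) : E3 :=
  (D.ρ * (D.α * (z.2 - D.θr) + D.β * (D.P.cl z - D.cr))) • !₂[(0 : ℝ), 0, -D.grav]

/-- `inf_Λ θδ` for `Λ = Γbt × (0,T)` (essential infimum). -/
def infΛ : EReal :=
  essInf (fun t => essInf (fun x => ((D.θδ t x : ℝ) : EReal)) (surf.restrict (D.Γb ∪ D.Γt)))
    (volume.restrict (Ioo 0 D.T))

/-- `sup_Λ θδ` for `Λ = Γbt × (0,T)` (essential supremum). -/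
def supΛ : EReal :=
  essSup (fun t => essSup (fun x => ((D.θδ t x : ℝ) : EReal)) (surf.restrict (D.Γb ∪ D.Γt)))
    (volume.restrict (Ioo 0 D.T))

/-- `min {inf_Ω θ₀, inf_Λ θδ}`, an extended real because `θ₀` is only in `L²(Ω)`. -/
def θinf (θ₀ : E3 → ℝ) : EReal :=
  min (essInf (fun x => (θ₀ x : EReal)) (volume.restrict D.Ω)) D.infΛ

/-- `max {sup_Ω θ₀, sup_Λ θδ}`, an extended real because `θ₀` is only in `L²(Ω)`. -/
def θsup (θ₀ : E3 → ℝ) : EReal :=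
  max (essSup (fun x => (θ₀ x : EReal)) (volume.restrict D.Ω)) D.supΛ

end Data

/-! ### Weak reproductive solutions -/

/-- `(c, θ, v)` is a weak reproductive solution with time-periodic values `c₀, θ₀, v₀`; here `Dc`,
`Dθ`, `Dv · i`, `Dcl` are the weak spatial gradients of `c`, `θ`, the `i`-th component of `v`, and
`cl(c, θ)`. No bound on `c` is part of the definition. -/
structure IsWeakReproductiveSolutionWith (D : Data)
    (c θ : ℝ → E3 → ℝ) (v : ℝ → E3 → E3) (c₀ θ₀ : E3 → ℝ) (v₀ : E3 → E3)
    (Dc Dθ : ℝ → E3 → E3) (Dv : ℝ → Fin 3 → E3 → E3) (Dcl : ℝ → E3 → E3) : Prop where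
  c₀_mem : MemLp c₀ 2 (volume.restrict D.Ω)
  θ₀_mem : MemLp θ₀ 2 (volume.restrict D.Ω)
  v₀_mem : MemH D.Ω v₀
  -- regularity
  c_mem : MemL2H1 D.Ω D.T c Dc
  c_bdd : BddInL2 D.Ω D.T c
  c_cont : WeaklyContinuousL2 D.Ω D.T c
  θ_mem : MemL2H1 D.Ω D.T θ Dθ
  θ_bdd : BddInL2 D.Ω D.T θ
  θ_cont : WeaklyContinuousL2 D.Ω D.T θ
  cl_mem : MemL2H1 D.Ω D.T (fun t x => D.P.cl (c t x, θ t x)) Dcl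
  v_memLp : MemLp (fun p : ℝ × E3 => v p.1 p.2) 2 D.Q
  Dv_memLp : ∀ i, MemLp (fun p : ℝ × E3 => Dv p.1 i p.2) 2 D.Q
  v_memHv : ∀ᵐ t ∂volume.restrict (Ioo 0 D.T), MemHv D.Ω D.Γbt D.Γv (v t) (Dv t)
  v_memH : ∀ᵐ t ∂volume.restrict (Ioo 0 D.T), MemH D.Ω (v t)
  v_bdd : BddInL2 D.Ω D.T v
  v_limit_zero : WeakTimeLimit D.Ω v (𝓝[>] 0) (v 0)
  v_limit_T : WeakTimeLimit D.Ω v (𝓝[<] D.T) (v D.T)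
  -- values at the times `0` and `T`
  c_T : ∀ᵐ x ∂volume.restrict D.Ω, c D.T x = c₀ x
  θ_T : ∀ᵐ x ∂volume.restrict D.Ω, θ D.T x = θ₀ x
  v_T : ∀ᵐ x ∂volume.restrict D.Ω, v D.T x = v₀ x
  c_periodic : ∀ᵐ x ∂volume.restrict D.Ω, c 0 x = c D.T x
  θ_periodic : ∀ᵐ x ∂volume.restrict D.Ω, θ 0 x = θ D.T x
  v_periodic : ∀ᵐ x ∂volume.restrict D.Ω, v 0 x = v D.T x
  -- mass constraint, boundary temperature, rest in the solid
  mass : ∀ᵐ t ∂volume.restrict (Ioo 0 D.T), ∫ x in D.Ω, c t x = D.cg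
  θ_boundary : ∀ᵐ t ∂volume.restrict (Ioo 0 D.T), MemHtheta D.Ω D.Γbt
    (fun x => θ t x - D.ext t x) (fun x => Dθ t x - D.Dext t x)
  v_solid : ∀ᵐ p ∂D.Q, (c p.1 p.2, θ p.1 p.2) ∈ D.P.zoneS → v p.1 p.2 = 0
  -- the equations, in the sense of distributions on `(0,T)`
  eq_c : ∀ φ Dφ, IsH1 D.Ω φ Dφ → ∀ ζ, IsTimeTest D.T ζ →
    -(∫ t in Ioo 0 D.T, deriv ζ t * ∫ x in D.Ω, c t x * φ x)
      + ∫ t in Ioo 0 D.T, ζ t *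
        (D.η * (∫ x in D.Ω, inner ℝ (Dc t x) (Dφ x))
          + ∫ x in D.Ω, inner ℝ (v t x) (Dcl t x) * φ x) = 0
  eq_θ : ∀ ψ Dψ, MemHtheta D.Ω D.Γbt ψ Dψ → ∀ ζ, IsTimeTest D.T ζ →
    -(∫ t in Ioo 0 D.T, deriv ζ t * ∫ x in D.Ω, θ t x * ψ x)
      + ∫ t in Ioo 0 D.T, ζ t *
        (D.κ * (∫ x in D.Ω, inner ℝ (Dθ t x) (Dψ x))
          + D.ρ * D.Cp * ∫ x in D.Ω, inner ℝ (v t x) (Dθ t x) * ψ x) = 0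
  -- test functions `w ζ` supported in the mixture-liquid part of the cylinder: `w` vanishes outside
  -- a compact `K ⊆ Ω`, and on `K × supp ζ` the pair `(c, θ)` stays in a compact part of that zone
  eq_v : ∀ w Dw, MemHv D.Ω D.Γbt D.Γv w Dw → ∀ ζ, IsTimeTest D.T ζ →
    ∀ K : Set E3, IsCompact K → K ⊆ D.Ω → (∀ᵐ x ∂volume.restrict D.Ω, x ∉ K → w x = 0) →
    ∀ C : Set (ℝ × ℝ), IsCompact C → C ⊆ D.P.zoneML →
    (∀ᵐ p ∂D.Q, p.1 ∈ tsupport ζ → p.2 ∈ K → (c p.1 p.2, θ p.1 p.2) ∈ C) →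
    -(∫ t in Ioo 0 D.T, deriv ζ t * ∫ x in D.Ω, inner ℝ (v t x) (w x))
      + ∫ t in Ioo 0 D.T, ζ t *
        (D.ν * (∫ x in D.Ω, ∑ i, inner ℝ (Dv t i x) (Dw i x))
          + D.ρ * (∫ x in D.Ω, ∑ i, inner ℝ (v t x) (Dv t i x) * w x i)
          + ∫ x in D.Ω, D.Fi (c t x, θ t x) * inner ℝ (v t x) (w x))
      = ∫ t in Ioo 0 D.T, ζ t * ∫ x in D.Ω, inner ℝ (D.Fe (c t x, θ t x)) (w x)

/-- `(c, θ, v)` is a weak reproductive solution at time `T`, where `c₀, θ₀, v₀` are the common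
values at the times `0` and `T`. -/
def IsWeakReproductiveSolution (D : Data)
    (c θ : ℝ → E3 → ℝ) (v : ℝ → E3 → E3) (c₀ θ₀ : E3 → ℝ) (v₀ : E3 → E3) : Prop :=
  ∃ Dc Dθ Dv Dcl, IsWeakReproductiveSolutionWith D c θ v c₀ θ₀ v₀ Dc Dθ Dv Dcl

end

end Solidification

namespace Solidification

noncomputable section

/-!
Let `Φ` be convex with bounded slope. Convexity gives
`Φ (u t) - Φ (u (t - h)) ≤ Φ' (u t) * (u t - u (t - h))`, so testing the equation, at each fixed
time `t`, with the time-independent function `Φ' (u t)`, and averaging over backward time steps `h`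
that tend to zero, gives an energy inequality for `∫ Φ (u)` without any regularity of `∂ₜ u`.

For the concentration, `Φ' (c)` is supported where `cl (c, θ)` is constant, so the transport term
vanishes because weak gradients vanish on level sets. By periodicity the dissipation is then zero,
so that `Φ' (c t)` is constant in space, and the mass constraint forces this constant to be zero.

For the temperature, `Φ' (θ)` vanishes on `Γb ∪ Γt` and is an admissible test function, and the
transport term is a multiple of `∫ v · ∇ (Φ (θ))`, which vanishes because `v t ∈ H`. Hence
`∫ Φ (θ)` stays zero if it is zero initially.
-/

/-! ### Convergence in `L^p` -/

section Lp

variable {α F : Type*} [MeasurableSpace α] {μ : Measure α} {p : ℝ≥0∞} [NormedAddCommGroup F]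

theorem tendsto_eLpNorm_zero_of_norm_le_mul {E : Type*} [NormedAddCommGroup E] {f : ℕ → α → F}
    {g : ℕ → α → E} {C : ℝ} (hfg : ∀ n x, ‖f n x‖ ≤ C * ‖g n x‖)
    (hg : Tendsto (fun n => eLpNorm (g n) p μ) atTop (𝓝 0)) :
    Tendsto (fun n => eLpNorm (f n) p μ) atTop (𝓝 0) := by
  have hlim : Tendsto (fun n => ENNReal.ofReal C * eLpNorm (g n) p μ) atTop (𝓝 0) := by
    simpa using ENNReal.Tendsto.const_mul hg (.inr ENNReal.ofReal_ne_top)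
  exact tendsto_of_tendsto_of_tendsto_of_le_of_le tendsto_const_nhds hlim (fun _ => zero_le)
    fun n => eLpNorm_le_mul_eLpNorm_of_ae_le_mul (.of_forall (hfg n)) p

theorem tendsto_eLpNorm_comp_sub {f : ℕ → α → ℝ} {w : α → ℝ} {G : ℝ → ℝ} {C : NNReal}
    (hG : LipschitzWith C G)
    (hf : Tendsto (fun n => eLpNorm (fun x => f n x - w x) p μ) atTop (𝓝 0)) :
    Tendsto (fun n => eLpNorm (fun x => G (f n x) - G (w x)) p μ) atTop (𝓝 0) :=
  tendsto_eLpNorm_zero_of_norm_le_mul (fun _ _ => hG.norm_sub_le _ _) hf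

theorem tendsto_eLpNorm_add_sub {f g : ℕ → α → F} {f₀ g₀ : α → F} (hp : 1 ≤ p)
    (hf : ∀ n, AEStronglyMeasurable (f n) μ) (hg : ∀ n, AEStronglyMeasurable (g n) μ)
    (hf₀ : AEStronglyMeasurable f₀ μ) (hg₀ : AEStronglyMeasurable g₀ μ)
    (hff₀ : Tendsto (fun n => eLpNorm (fun x => f n x - f₀ x) p μ) atTop (𝓝 0))
    (hgg₀ : Tendsto (fun n => eLpNorm (fun x => g n x - g₀ x) p μ) atTop (𝓝 0)) :
    Tendsto (fun n => eLpNorm (fun x => (f n x + g n x) - (f₀ x + g₀ x)) p μ) atTop (𝓝 0) := by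
  refine tendsto_of_tendsto_of_tendsto_of_le_of_le tendsto_const_nhds
    (by simpa using hff₀.add hgg₀) (fun _ => zero_le) fun n => ?_
  simp only [add_sub_add_comm]
  exact eLpNorm_add_le ((hf n).sub hf₀) ((hg n).sub hg₀) hp

theorem tendsto_eLpNorm_zero_of_dominated {E : Type*} [NormedAddCommGroup E] {f : ℕ → α → F}
    {g : α → E} (hp₀ : p ≠ 0) (hp : p ≠ ⊤) (hf : ∀ n, AEStronglyMeasurable (f n) μ)
    (hfg : ∀ n x, ‖f n x‖ ≤ ‖g x‖) (hg : MemLp g p μ)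
    (hlim : ∀ᵐ x ∂μ, Tendsto (fun n => f n x) atTop (𝓝 0)) :
    Tendsto (fun n => eLpNorm (f n) p μ) atTop (𝓝 0) := by
  have hp' : 0 < p.toReal := ENNReal.toReal_pos hp₀ hp
  have hint : Tendsto (fun n => ∫⁻ x, ‖f n x‖ₑ ^ p.toReal ∂μ) atTop (𝓝 (∫⁻ _, 0 ∂μ)) := by
    refine tendsto_lintegral_of_dominated_convergence' (fun x => ‖g x‖ₑ ^ p.toReal)
      (fun n => (hf n).enorm.pow_const _) (fun n => .of_forall fun x => ?_) ?_ ?_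
    · exact ENNReal.rpow_le_rpow (enorm_le_iff_norm_le.2 (hfg n x)) hp'.le
    · exact ((eLpNorm_lt_top_iff_lintegral_rpow_enorm_lt_top hp₀ hp).1 hg.eLpNorm_lt_top).ne
    · filter_upwards [hlim] with x hx
      simpa [hp'] using hx.enorm.ennrpow_const p.toReal
  simp only [eLpNorm_eq_lintegral_rpow_enorm_toReal hp₀ hp]
  simpa [hp'] using hint.ennrpow_const (1 / p.toReal)

variable [NormedSpace ℝ F] {a : ℕ → α → ℝ} {C : ℝ}

theorem tendsto_eLpNorm_smul_sub_smul {a₀ : α → ℝ} {D : α → F} (hp₀ : p ≠ 0) (hp : p ≠ ⊤)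
    (ha : ∀ n, AEStronglyMeasurable (a n) μ) (ha₀ : AEStronglyMeasurable a₀ μ)
    (hC : ∀ n x, ‖a n x‖ ≤ C) (hC₀ : ∀ x, ‖a₀ x‖ ≤ C)
    (hlim : ∀ᵐ x ∂μ, Tendsto (fun n => a n x) atTop (𝓝 (a₀ x))) (hD : MemLp D p μ) :
    Tendsto (fun n => eLpNorm (fun x => a n x • D x - a₀ x • D x) p μ) atTop (𝓝 0) := by
  simp only [← sub_smul]
  refine tendsto_eLpNorm_zero_of_dominated (g := fun x => (C + C) • D x) hp₀ hp
    (fun n => ((ha n).sub ha₀).smul hD.aestronglyMeasurable) (fun n x => ?_)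
    (hD.const_smul _) ?_
  · rw [norm_smul, norm_smul]
    gcongr
    exact ((norm_sub_le _ _).trans (add_le_add (hC n x) (hC₀ x))).trans (le_abs_self _)
  · filter_upwards [hlim] with x hx
    simpa using (hx.sub_const (a₀ x)).smul_const (D x)

theorem tendsto_eLpNorm_smul_sub {a₀ : α → ℝ} {D : ℕ → α → F} {D₀ : α → F} (hp₁ : 1 ≤ p)
    (hp : p ≠ ⊤) (ha : ∀ n, AEStronglyMeasurable (a n) μ) (ha₀ : AEStronglyMeasurable a₀ μ)
    (hC : ∀ n x, ‖a n x‖ ≤ C) (hC₀ : ∀ x, ‖a₀ x‖ ≤ C)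
    (hlim : ∀ᵐ x ∂μ, Tendsto (fun n => a n x) atTop (𝓝 (a₀ x)))
    (hD : ∀ n, AEStronglyMeasurable (D n) μ) (hD₀ : MemLp D₀ p μ)
    (hDD₀ : Tendsto (fun n => eLpNorm (fun x => D n x - D₀ x) p μ) atTop (𝓝 0)) :
    Tendsto (fun n => eLpNorm (fun x => a n x • D n x - a₀ x • D₀ x) p μ) atTop (𝓝 0) := by
  have hmul := tendsto_eLpNorm_smul_sub_smul (zero_lt_one.trans_le hp₁).ne' hp ha ha₀ hC hC₀ hlim
    hD₀
  have hdiff : Tendsto (fun n => eLpNorm (fun x => a n x • (D n x - D₀ x)) p μ) atTop (𝓝 0) := by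
    refine tendsto_eLpNorm_zero_of_norm_le_mul (C := C) (fun n x => ?_) hDD₀
    rw [norm_smul]
    gcongr
    exact hC n x
  have hD₀m := hD₀.aestronglyMeasurable
  refine tendsto_of_tendsto_of_tendsto_of_le_of_le tendsto_const_nhds
    (by simpa using hmul.add hdiff) (fun _ => zero_le) fun n => ?_
  have hsplit : ∀ x, a n x • D n x - a₀ x • D₀ x
      = (a n x • D₀ x - a₀ x • D₀ x) + a n x • (D n x - D₀ x) := fun x => by module
  simp only [hsplit]
  exact eLpNorm_add_le (((ha n).smul hD₀m).sub (ha₀.smul hD₀m))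
    ((ha n).smul ((hD n).sub hD₀m)) hp₁

end Lp

section Mollification

variable {V : Type*} [NormedAddCommGroup V] [NormedSpace ℝ V] [FiniteDimensional ℝ V]
  [MeasurableSpace V] [BorelSpace V] {μ : Measure V} [μ.IsAddHaarMeasure]
  {F : Type*} [NormedAddCommGroup F]

theorem tendsto_eLpNorm_translate_sub {p : ℝ≥0∞} (hp1 : 1 ≤ p) (hp : p ≠ ⊤) {f : V → F}
    (hf : MemLp f p μ) :
    Tendsto (fun y => eLpNorm (fun x => f (x - y) - f x) p μ) (𝓝 0) (𝓝 0) := by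
  have : Fact (1 ≤ p) := ⟨hp1⟩
  have : ProperSpace V := FiniteDimensional.proper ℝ V
  let τ : V → C(V, V) := fun y => ⟨fun x => x - y, by fun_prop⟩
  have hτ : Continuous τ :=
    (ContinuousMap.curry ⟨fun a : V × V => a.2 - a.1, by fun_prop⟩).continuous
  have hτμ : ∀ y, MeasurePreserving (τ y) μ μ := measurePreserving_sub_right μ
  have hcoe : ∀ y, Lp.compMeasurePreserving (τ y) (hτμ y) (hf.toLp f)
      =ᵐ[μ] fun x => f (x - y) := fun y =>
    (Lp.coeFn_compMeasurePreserving _ _).trans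
      ((hτμ y).quasiMeasurePreserving.ae_eq_comp hf.coeFn_toLp)
  have hlim := Filter.Tendsto.compMeasurePreservingLp (f := fun _ : V => hf.toLp f)
    tendsto_const_nhds (hτ.tendsto 0) hτμ (hτμ 0) hp
  refine (tendsto_iff_edist_tendsto_0.1 hlim).congr fun y => ?_
  rw [Lp.edist_def]
  refine eLpNorm_congr_ae ?_
  filter_upwards [hcoe y, hcoe 0] with x hy h0
  simp only [Pi.sub_apply, hy, h0, sub_zero]

open ContinuousLinearMap in
theorem eLpNorm_convolution_sub_le [NormedSpace ℝ F] [CompleteSpace F] {ρ : V → ℝ} {f : V → F}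
    {ε : ℝ≥0∞} (hρ : Integrable ρ μ) (hρ₀ : 0 ≤ ρ) (hρ₁ : ∫ y, ρ y ∂μ = 1) (hf : Integrable f μ)
    (hε : ∀ y ∈ Function.support ρ, eLpNorm (fun x => f (x - y) - f x) 1 μ ≤ ε) :
    eLpNorm (fun x => convolution ρ f (lsmul ℝ ℝ) μ x - f x) 1 μ ≤ ε := by
  have hconv : Integrable (fun z : V × V => ρ z.2 • f (z.1 - z.2)) (μ.prod μ) :=
    hρ.convolution_integrand (lsmul ℝ ℝ) hf
  have hint : Integrable (fun z : V × V => ρ z.2 • (f (z.1 - z.2) - f z.1)) (μ.prod μ) := by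
    simp only [smul_sub]
    exact hconv.sub (hρ.smul_prod hf).swap
  have hpoint : ∀ᵐ x ∂μ, ‖convolution ρ f (lsmul ℝ ℝ) μ x - f x‖ₑ
      ≤ ∫⁻ y, ‖ρ y • (f (x - y) - f x)‖ₑ ∂μ := by
    filter_upwards [hconv.prod_right_ae] with x hx
    have : convolution ρ f (lsmul ℝ ℝ) μ x - f x = ∫ y, ρ y • (f (x - y) - f x) ∂μ := by
      simp only [smul_sub]
      rw [integral_sub hx (hρ.smul_const _), integral_smul_const, hρ₁, one_smul]
      rfl
    rw [this]
    exact enorm_integral_le_lintegral_enorm _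
  rw [eLpNorm_one_eq_lintegral_enorm]
  calc ∫⁻ x, ‖convolution ρ f (lsmul ℝ ℝ) μ x - f x‖ₑ ∂μ
      ≤ ∫⁻ x, ∫⁻ y, ‖ρ y • (f (x - y) - f x)‖ₑ ∂μ ∂μ := lintegral_mono_ae hpoint
    _ = ∫⁻ y, ∫⁻ x, ‖ρ y • (f (x - y) - f x)‖ₑ ∂μ ∂μ :=
        lintegral_lintegral_swap hint.aestronglyMeasurable.enorm
    _ ≤ ∫⁻ y, ‖ρ y‖ₑ * ε ∂μ := by
        refine lintegral_mono fun y => ?_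
        simp only [enorm_smul]
        rw [lintegral_const_mul' _ _ enorm_ne_top, ← eLpNorm_one_eq_lintegral_enorm]
        by_cases hy : ρ y = 0
        · simp [hy]
        · gcongr
          exact hε y hy
    _ = ε := by
        rw [lintegral_mul_const'' _ hρ.aestronglyMeasurable.enorm,
          ← ofReal_integral_norm_eq_lintegral_enorm hρ]
        simp [abs_of_nonneg (hρ₀ _), hρ₁]

theorem tendsto_eLpNorm_convolution_sub [NormedSpace ℝ F] [CompleteSpace F] {f : V → F}
    (hf : Integrable f μ) {φ : ℕ → ContDiffBump (0 : V)}
    (hφ : Tendsto (fun n => (φ n).rOut) atTop (𝓝 0)) :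
    Tendsto (fun n => eLpNorm
        (fun x => convolution ((φ n).normed μ) f (ContinuousLinearMap.lsmul ℝ ℝ) μ x - f x) 1 μ)
      atTop (𝓝 0) := by
  refine ENNReal.tendsto_nhds_zero.2 fun ε hε => ?_
  obtain ⟨δ, hδ, hball⟩ := Metric.eventually_nhds_iff.1 <| ENNReal.tendsto_nhds_zero.1
    (tendsto_eLpNorm_translate_sub le_rfl ENNReal.one_ne_top (memLp_one_iff_integrable.2 hf)) ε hε
  filter_upwards [hφ.eventually (gt_mem_nhds hδ)] with n hn
  refine eLpNorm_convolution_sub_le (φ n).integrable_normed (fun y => (φ n).nonneg_normed y)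
    (φ n).integral_normed hf fun y hy => hball ?_
  rw [(φ n).support_normed_eq] at hy
  exact (Metric.mem_ball.1 hy).trans hn

end Mollification

/-! ### Weak derivatives -/

section Bump

variable (V : Type*) [NormedAddCommGroup V]

/-- The standard sequence of bump functions at the origin, with radii `1 / (n + 1)`, whose
normalizations serve as mollifiers. -/
def bump (n : ℕ) : ContDiffBump (0 : V) where
  rIn := 1 / (n + 1 : ℝ) / 2
  rOut := 1 / (n + 1 : ℝ)
  rIn_pos := by positivity
  rIn_lt_rOut := half_lt_self (by positivity)

theorem tendsto_rOut_bump : Tendsto (fun n => (bump V n).rOut) atTop (𝓝 0) :=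
  tendsto_one_div_add_atTop_nhds_zero_nat

variable {V} in
theorem eventually_closedBall_bump_subset {Ω K : Set V} (hΩ : IsOpen Ω) (hK : IsCompact K)
    (hKΩ : K ⊆ Ω) : ∀ᶠ n in atTop, ∀ x ∈ K, Metric.closedBall x (bump V n).rOut ⊆ Ω := by
  obtain ⟨δ, hδ, hsub⟩ := hK.exists_cthickening_subset_open hΩ hKΩ
  filter_upwards [(tendsto_rOut_bump V).eventually (gt_mem_nhds hδ)] with n hn x hx
  exact ((Metric.closedBall_subset_closedBall hn.le).trans
    (Metric.closedBall_subset_cthickening hx δ)).trans hsub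

end Bump

section WeakDerivative

open ContinuousLinearMap

variable {V : Type*} [NormedAddCommGroup V] [NormedSpace ℝ V] {Ω : Set V} {u φ : V → ℝ}
  {g : V → V →L[ℝ] ℝ}

theorem continuous_fderiv_apply (hφ : ContDiff ℝ ∞ φ) (y : V) :
    Continuous (fun x => fderiv ℝ φ x y) :=
  (hφ.continuous_fderiv (by simp)).clm_apply continuous_const

theorem exists_norm_fderiv_apply_le (hφ : ContDiff ℝ ∞ φ) (hφs : HasCompactSupport φ) (y : V) :
    ∃ C, ∀ x, ‖fderiv ℝ φ x y‖ ≤ C :=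
  (hφs.fderiv_apply ℝ y).exists_bound_of_continuous (continuous_fderiv_apply hφ y)

variable [MeasureSpace V]

theorem HasWeakFDeriv.setIntegral_reflect (hw : HasWeakFDeriv Ω u g) {ρ : V → ℝ}
    (hρ : ContDiff ℝ ∞ ρ) (hρs : HasCompactSupport ρ) {x : V}
    (hx : (fun t => x - t) ⁻¹' tsupport ρ ⊆ Ω) (y : V) :
    ∫ t in Ω, fderiv ℝ ρ (x - t) y * u t = ∫ t in Ω, ρ (x - t) * g t y := by
  have hder : ∀ t, fderiv ℝ (fun t => ρ (x - t)) t y = -fderiv ℝ ρ (x - t) y := fun t => by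
    have := (hρ.differentiable (by simp) (x - t)).hasFDerivAt.comp t
      ((hasFDerivAt_id t).const_sub x)
    have hfd : fderiv ℝ (fun t => ρ (x - t)) t = _ := this.fderiv
    simp [hfd]
  have := hw (fun t => ρ (x - t)) (hρ.comp (contDiff_const.sub contDiff_id))
    (hρs.comp_homeomorph (Homeomorph.subLeft x))
    ((tsupport_comp_subset_preimage ρ (by fun_prop)).trans hx) y
  simp only [hder, mul_neg, integral_neg, neg_inj] at this
  simpa only [mul_comm] using this

variable [BorelSpace V]

theorem integrableOn_mul_fderiv (hu : IntegrableOn u Ω) (hφ : ContDiff ℝ ∞ φ)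
    (hφs : HasCompactSupport φ) (y : V) : IntegrableOn (fun x => u x * fderiv ℝ φ x y) Ω := by
  obtain ⟨C, hC⟩ := exists_norm_fderiv_apply_le hφ hφs y
  exact hu.mul_bdd (continuous_fderiv_apply hφ y).aestronglyMeasurable (.of_forall hC)

theorem integrableOn_mul_apply (hg : IntegrableOn g Ω) (hφ : ContDiff ℝ ∞ φ)
    (hφs : HasCompactSupport φ) (y : V) : IntegrableOn (fun x => φ x * g x y) Ω := by
  obtain ⟨C, hC⟩ := hφs.exists_bound_of_continuous hφ.continuous
  exact (hg.apply_continuousLinearMap y).bdd_mul hφ.continuous.aestronglyMeasurable (.of_forall hC)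

theorem HasWeakFDeriv.add {u₁ u₂ : V → ℝ} {g₁ g₂ : V → V →L[ℝ] ℝ}
    (h₁ : HasWeakFDeriv Ω u₁ g₁) (h₂ : HasWeakFDeriv Ω u₂ g₂)
    (hu₁ : IntegrableOn u₁ Ω) (hu₂ : IntegrableOn u₂ Ω)
    (hg₁ : IntegrableOn g₁ Ω) (hg₂ : IntegrableOn g₂ Ω) :
    HasWeakFDeriv Ω (fun x => u₁ x + u₂ x) (fun x => g₁ x + g₂ x) := by
  intro φ hφ hφs hφΩ y
  simp only [add_apply, mul_add, add_mul]
  rw [integral_add (integrableOn_mul_fderiv hu₁ hφ hφs y) (integrableOn_mul_fderiv hu₂ hφ hφs y),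
    integral_add (integrableOn_mul_apply hg₁ hφ hφs y) (integrableOn_mul_apply hg₂ hφ hφs y),
    h₁ φ hφ hφs hφΩ y, h₂ φ hφ hφs hφΩ y, neg_add]

theorem hasWeakFDeriv_of_tendsto {u : ℕ → V → ℝ} {g : ℕ → V → V →L[ℝ] ℝ} {u₀ : V → ℝ}
    {g₀ : V → V →L[ℝ] ℝ} (hu : ∀ n, IntegrableOn (u n) Ω) (hg : ∀ n, IntegrableOn (g n) Ω)
    (hu₀ : AEStronglyMeasurable u₀ (volume.restrict Ω))
    (hg₀ : AEStronglyMeasurable g₀ (volume.restrict Ω))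
    (huu₀ : Tendsto (fun n => eLpNorm (fun x => u n x - u₀ x) 1 (volume.restrict Ω)) atTop (𝓝 0))
    (hgg₀ : Tendsto (fun n => eLpNorm (fun x => g n x - g₀ x) 1 (volume.restrict Ω)) atTop (𝓝 0))
    (hweak : ∀ φ : V → ℝ, ContDiff ℝ ∞ φ → HasCompactSupport φ → tsupport φ ⊆ Ω → ∀ y,
      ∀ᶠ n in atTop, ∫ x in Ω, u n x * fderiv ℝ φ x y = -∫ x in Ω, φ x * g n x y) :
    HasWeakFDeriv Ω u₀ g₀ := by
  intro φ hφ hφs hφΩ y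
  have hφm := hφ.continuous.aestronglyMeasurable (μ := volume.restrict Ω)
  have hdφm := (continuous_fderiv_apply hφ y).aestronglyMeasurable (μ := volume.restrict Ω)
  obtain ⟨A, hA⟩ := hφs.exists_bound_of_continuous hφ.continuous
  obtain ⟨B, hB⟩ := exists_norm_fderiv_apply_le hφ hφs y
  have hlimL : Tendsto (fun n => ∫ x in Ω, u n x * fderiv ℝ φ x y) atTop
      (𝓝 (∫ x in Ω, u₀ x * fderiv ℝ φ x y)) := by
    refine tendsto_integral_of_L1' _ (hu₀.mul hdφm)
      (.of_forall fun n => integrableOn_mul_fderiv (hu n) hφ hφs y)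
      (tendsto_eLpNorm_zero_of_norm_le_mul (C := B) (fun n x => ?_) huu₀)
    rw [Pi.sub_apply, Pi.mul_apply, ← sub_mul, norm_mul, mul_comm]
    gcongr
    exact hB x
  have hlimR : Tendsto (fun n => ∫ x in Ω, φ x * g n x y) atTop
      (𝓝 (∫ x in Ω, φ x * g₀ x y)) := by
    refine tendsto_integral_of_L1' _ (hφm.mul (hg₀.apply_continuousLinearMap y))
      (.of_forall fun n => integrableOn_mul_apply (hg n) hφ hφs y)
      (tendsto_eLpNorm_zero_of_norm_le_mul (C := A * ‖y‖) (fun n x => ?_) hgg₀)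
    rw [Pi.sub_apply, Pi.mul_apply, ← mul_sub, ← sub_apply, norm_mul, mul_right_comm, mul_assoc]
    gcongr
    · exact (norm_nonneg _).trans (hA x)
    · exact hA x
    · exact le_opNorm _ _
  exact tendsto_nhds_unique (hlimL.congr' (hweak φ hφ hφs hφΩ y)) hlimR.neg

variable [FiniteDimensional ℝ V]

theorem ae_eq_zero_of_hasWeakFDeriv_zero (hΩ : IsOpen Ω) (hg : IntegrableOn g Ω)
    (hw : HasWeakFDeriv Ω (fun _ => 0) g) : ∀ᵐ x ∂volume.restrict Ω, g x = 0 := by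
  rw [ae_restrict_iff' hΩ.measurableSet]
  refine hΩ.ae_eq_zero_of_integral_contDiff_smul_eq_zero hg.locallyIntegrableOn
    fun φ hφ hφs hφΩ => ?_
  obtain ⟨A, hA⟩ := hφs.exists_bound_of_continuous hφ.continuous
  have hφg : IntegrableOn (fun x => φ x • g x) Ω :=
    hg.bdd_smul A hφ.continuous.aestronglyMeasurable (.of_forall hA)
  rw [← setIntegral_eq_integral_of_forall_compl_eq_zero (s := Ω) fun x hx => by
    rw [image_eq_zero_of_notMem_tsupport fun h => hx (hφΩ h), zero_smul]]
  ext y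
  rw [integral_apply hφg]
  simpa using (hw φ hφ hφs hφΩ y).symm

variable [(volume : Measure V).IsAddHaarMeasure]

theorem setIntegral_mul_fderiv_eq_neg {f : V → ℝ} (hf : ContDiff ℝ 1 f) (hφ : ContDiff ℝ ∞ φ)
    (hφs : HasCompactSupport φ) (hφΩ : tsupport φ ⊆ Ω) (y : V)
    (hfg : ∀ x ∈ tsupport φ, fderiv ℝ f x = g x) :
    ∫ x in Ω, f x * fderiv ℝ φ x y = -∫ x in Ω, φ x * g x y := by
  have hdf : Continuous (fun x => fderiv ℝ f x y) :=
    (hf.continuous_fderiv (by simp)).clm_apply continuous_const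
  have hzero : ∀ x ∉ Ω, φ x = 0 := fun x hx =>
    image_eq_zero_of_notMem_tsupport fun h => hx (hφΩ h)
  have hdzero : ∀ x ∉ Ω, fderiv ℝ φ x y = 0 := fun x hx => by
    rw [fderiv_of_notMem_tsupport ℝ fun h => hx (hφΩ h), zero_apply]
  rw [setIntegral_eq_integral_of_forall_compl_eq_zero fun x hx => by rw [hdzero x hx, mul_zero],
    setIntegral_eq_integral_of_forall_compl_eq_zero fun x hx => by rw [hzero x hx, zero_mul],
    integral_mul_fderiv_eq_neg_fderiv_mul_of_integrable
      ((hdf.mul hφ.continuous).integrable_of_hasCompactSupport hφs.mul_left)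
      ((hf.continuous.mul (continuous_fderiv_apply hφ y)).integrable_of_hasCompactSupport
        (hφs.fderiv_apply ℝ y).mul_left)
      ((hf.continuous.mul hφ.continuous).integrable_of_hasCompactSupport hφs.mul_left)
      (fun x _ => hf.differentiable (by simp) x) (fun x _ => hφ.differentiable (by simp) x)]
  congr 1
  refine integral_congr_ae (.of_forall fun x => ?_)
  by_cases hx : x ∈ tsupport φ
  · simp only [hfg x hx, mul_comm]
  · simp only [image_eq_zero_of_notMem_tsupport hx, mul_zero, zero_mul]

theorem HasWeakFDeriv.add_const (hw : HasWeakFDeriv Ω u g) (hu : IntegrableOn u Ω) (k : ℝ) :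
    HasWeakFDeriv Ω (fun x => u x + k) g := by
  intro φ hφ hφs hφΩ y
  have hconst : ∫ x in Ω, k * fderiv ℝ φ x y = -∫ x in Ω, φ x * (0 : V →L[ℝ] ℝ) y :=
    setIntegral_mul_fderiv_eq_neg contDiff_const hφ hφs hφΩ y fun x _ => by simp
  simp only [add_mul]
  rw [integral_add (integrableOn_mul_fderiv hu hφ hφs y), hw φ hφ hφs hφΩ y, hconst]
  · simp
  · exact (((continuous_fderiv_apply hφ y).integrable_of_hasCompactSupport
      (hφs.fderiv_apply ℝ y)).const_mul k).integrableOn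

/-- Mollification by the normalized bump function `b` of the extension by zero of `f|_Ω`. -/
def mollify {F : Type*} [NormedAddCommGroup F] [NormedSpace ℝ F] (b : ContDiffBump (0 : V))
    (Ω : Set V) (f : V → F) : V → F :=
  convolution (b.normed volume) (Ω.indicator f) (lsmul ℝ ℝ) volume

section Mollify

variable {F : Type*} [NormedAddCommGroup F] [NormedSpace ℝ F] {f : V → F}

theorem contDiff_mollify (hΩ : MeasurableSet Ω) (hf : IntegrableOn f Ω) (b : ContDiffBump (0 : V)) :
    ContDiff ℝ 1 (mollify b Ω f) :=
  b.hasCompactSupport_normed.contDiff_convolution_left (n := 1) _ b.contDiff_normed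
    (hf.integrable_indicator hΩ).locallyIntegrable

theorem integrable_mollify (hΩ : MeasurableSet Ω) (hf : IntegrableOn f Ω)
    (b : ContDiffBump (0 : V)) : Integrable (mollify b Ω f) :=
  b.integrable_normed.integrable_convolution _ (hf.integrable_indicator hΩ)

variable [CompleteSpace F]

theorem ae_tendsto_mollify (hΩ : MeasurableSet Ω) (hf : IntegrableOn f Ω) :
    ∀ᵐ x ∂volume.restrict Ω, Tendsto (fun n => mollify (bump V n) Ω f x) atTop (𝓝 (f x)) := by
  rw [ae_restrict_iff' hΩ]
  filter_upwards [ContDiffBump.ae_convolution_tendsto_right_of_locallyIntegrable (K := 2)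
    (tendsto_rOut_bump V) (.of_forall fun n => by simp only [bump]; linarith)
    (hf.integrable_indicator hΩ).locallyIntegrable] with x hx hxΩ
  rwa [indicator_of_mem hxΩ] at hx

theorem tendsto_eLpNorm_mollify_sub (hΩ : MeasurableSet Ω) (hf : IntegrableOn f Ω) :
    Tendsto (fun n => eLpNorm (fun x => mollify (bump V n) Ω f x - f x) 1 (volume.restrict Ω))
      atTop (𝓝 0) := by
  refine tendsto_of_tendsto_of_tendsto_of_le_of_le tendsto_const_nhds
    (tendsto_eLpNorm_convolution_sub (hf.integrable_indicator hΩ) (tendsto_rOut_bump V))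
    (fun _ => zero_le) fun n => ?_
  refine (eLpNorm_congr_ae ?_).trans_le (eLpNorm_mono_measure _ Measure.restrict_le_self)
  filter_upwards [ae_restrict_mem hΩ] with x hx
  rw [indicator_of_mem hx]
  rfl

end Mollify

theorem HasWeakFDeriv.hasFDerivAt_mollify (hw : HasWeakFDeriv Ω u g) (hΩ : MeasurableSet Ω)
    (hu : IntegrableOn u Ω) (hg : IntegrableOn g Ω) (b : ContDiffBump (0 : V)) {x : V}
    (hx : Metric.closedBall x b.rOut ⊆ Ω) :
    HasFDerivAt (mollify b Ω u) (mollify b Ω g x) x := by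
  have hui : LocallyIntegrable (Ω.indicator u) := (hu.integrable_indicator hΩ).locallyIntegrable
  have hgi : LocallyIntegrable (Ω.indicator g) :=
    (IntegrableOn.integrable_indicator (f := g) hg hΩ).locallyIntegrable
  set ρ := b.normed (volume : Measure V)
  have hρs : HasCompactSupport ρ := b.hasCompactSupport_normed
  have hρ : ContDiff ℝ ∞ ρ := b.contDiff_normed
  have hsupp : (fun t => x - t) ⁻¹' tsupport ρ ⊆ Ω := fun t ht => hx <| by
    rw [mem_preimage, b.tsupport_normed_eq, mem_closedBall_zero_iff] at ht
    rwa [Metric.mem_closedBall, dist_comm, dist_eq_norm]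
  refine (hρs.hasFDerivAt_convolution_left (lsmul ℝ ℝ) (hρ.of_le (by simp)) hui x).congr_fderiv ?_
  ext y
  rw [mollify, convolution_eq_swap, convolution_eq_swap, integral_apply
      ((hρs.fderiv ℝ).convolutionExists_left ((lsmul ℝ ℝ).precompL V)
        (hρ.continuous_fderiv (by simp)) hui x).integrable_swap,
    integral_apply (hρs.convolutionExists_left (lsmul ℝ ℝ) hρ.continuous hgi x).integrable_swap]
  calc ∫ t, ((lsmul ℝ ℝ).precompL V) (fderiv ℝ ρ (x - t)) (Ω.indicator u t) y
      = ∫ t, Ω.indicator (fun t => fderiv ℝ ρ (x - t) y * u t) t := by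
        refine integral_congr_ae (.of_forall fun t => ?_)
        by_cases ht : t ∈ Ω <;> simp [ht, precompL_apply]
    _ = ∫ t, Ω.indicator (fun t => ρ (x - t) * g t y) t := by
        rw [integral_indicator hΩ, integral_indicator hΩ, hw.setIntegral_reflect hρ hρs hsupp]
    _ = ∫ t, lsmul ℝ ℝ (ρ (x - t)) (Ω.indicator g t) y := by
        refine integral_congr_ae (.of_forall fun t => ?_)
        by_cases ht : t ∈ Ω <;> simp [ht]

theorem HasWeakFDeriv.comp_of_map_zero (hw : HasWeakFDeriv Ω u g) (hΩ : IsOpen Ω)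
    (hu : IntegrableOn u Ω) (hg : IntegrableOn g Ω) {G : ℝ → ℝ} {C : NNReal}
    (hG : ContDiff ℝ 1 G) (hC : LipschitzWith C G) (hG₀ : G 0 = 0) :
    HasWeakFDeriv Ω (fun x => G (u x)) (fun x => deriv G (u x) • g x) := by
  have hm := hΩ.measurableSet
  have hG' : Continuous (deriv G) := hG.continuous_deriv le_rfl
  set un : ℕ → V → ℝ := fun n => mollify (bump V n) Ω u
  set gn : ℕ → V → V →L[ℝ] ℝ := fun n => mollify (bump V n) Ω g
  have hun : ∀ n, IntegrableOn (un n) Ω := fun n => (integrable_mollify hm hu _).integrableOn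
  have hgn : ∀ n, IntegrableOn (gn n) Ω := fun n => (integrable_mollify hm hg _).integrableOn
  have hun₁ : ∀ n, ContDiff ℝ 1 (un n) := fun n => contDiff_mollify hm hu _
  have hG'un : ∀ n, AEStronglyMeasurable (fun x => deriv G (un n x)) (volume.restrict Ω) :=
    fun n => hG'.comp_aestronglyMeasurable (hun n).aestronglyMeasurable
  have hG'u : AEStronglyMeasurable (fun x => deriv G (u x)) (volume.restrict Ω) :=
    hG'.comp_aestronglyMeasurable hu.aestronglyMeasurable
  refine hasWeakFDeriv_of_tendsto (u := fun n x => G (un n x))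
    (g := fun n x => deriv G (un n x) • gn n x)
    (fun n => memLp_one_iff_integrable.1 (hC.comp_memLp hG₀ (memLp_one_iff_integrable.2 (hun n))))
    (fun n => (hgn n).bdd_smul C (hG'un n) (.of_forall fun x => norm_deriv_le_of_lipschitz hC))
    (hG.continuous.comp_aestronglyMeasurable hu.aestronglyMeasurable)
    (hG'u.smul hg.aestronglyMeasurable)
    (tendsto_eLpNorm_comp_sub hC (tendsto_eLpNorm_mollify_sub hm hu))
    (tendsto_eLpNorm_smul_sub le_rfl ENNReal.one_ne_top hG'un hG'u
      (fun n x => norm_deriv_le_of_lipschitz hC) (fun x => norm_deriv_le_of_lipschitz hC) ?_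
      (fun n => (hgn n).aestronglyMeasurable) (memLp_one_iff_integrable.2 hg)
      (tendsto_eLpNorm_mollify_sub hm hg)) ?_
  · filter_upwards [ae_tendsto_mollify hm hu] with x hx using (hG'.tendsto _).comp hx
  · intro φ hφ hφs hφΩ y
    filter_upwards [eventually_closedBall_bump_subset hΩ hφs hφΩ] with n hn
    refine setIntegral_mul_fderiv_eq_neg (hG.comp (hun₁ n)) hφ hφs hφΩ y fun x hx => ?_
    exact ((hG.differentiable one_ne_zero (un n x)).hasDerivAt.comp_hasFDerivAt x
      (hw.hasFDerivAt_mollify hm hu hg _ (hn x hx))).fderiv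

theorem HasWeakFDeriv.comp_lipschitz (hw : HasWeakFDeriv Ω u g) (hΩ : IsOpen Ω)
    (hu : IntegrableOn u Ω) (hg : IntegrableOn g Ω) {G : ℝ → ℝ} {C : NNReal}
    (hG : ContDiff ℝ 1 G) (hC : LipschitzWith C G) :
    HasWeakFDeriv Ω (fun x => G (u x)) (fun x => deriv G (u x) • g x) := by
  have hC₀ : LipschitzWith C fun s => G s - G 0 := fun a b => by simpa using hC a b
  have hint : IntegrableOn (fun x => G (u x) - G 0) Ω := memLp_one_iff_integrable.1 <|
    hC₀.comp_memLp (sub_self _) (memLp_one_iff_integrable.2 hu)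
  simpa using (hw.comp_of_map_zero hΩ hu hg (hG.sub contDiff_const) hC₀ (sub_self _)).add_const
    hint (G 0)

/-- Functions converging uniformly to zero, whose derivatives converge boundedly to the indicator
function of `{k}`. The constant makes them vanish at `0`. -/
def arctanSpike (k : ℝ) (n : ℕ) (s : ℝ) : ℝ :=
  (n + 1 : ℝ)⁻¹ * (Real.arctan ((n + 1) * (s - k)) - Real.arctan ((n + 1) * (0 - k)))

section ArctanSpike

variable (k : ℝ) (n : ℕ) (s : ℝ)

theorem deriv_arctanSpike : deriv (arctanSpike k n) s = (1 + ((n + 1) * (s - k)) ^ 2)⁻¹ := by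
  have hlin : HasDerivAt (fun s : ℝ => (n + 1 : ℝ) * (s - k)) (n + 1) s := by
    simpa using ((hasDerivAt_id s).sub_const k).const_mul (n + 1 : ℝ)
  have hder := (hlin.arctan.sub_const (Real.arctan ((n + 1) * (0 - k)))).const_mul (n + 1 : ℝ)⁻¹
  rw [show deriv (arctanSpike k n) s = _ from hder.deriv]
  field_simp

theorem contDiff_arctanSpike : ContDiff ℝ 1 (arctanSpike k n) := by
  unfold arctanSpike
  exact contDiff_const.mul ((Real.contDiff_arctan.comp (by fun_prop)).sub contDiff_const)

theorem lipschitzWith_arctanSpike : LipschitzWith 1 (arctanSpike k n) := by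
  refine lipschitzWith_of_nnnorm_deriv_le ((contDiff_arctanSpike k n).differentiable one_ne_zero)
    fun s => ?_
  rw [← NNReal.coe_le_coe, coe_nnnorm, deriv_arctanSpike, norm_inv, NNReal.coe_one]
  refine inv_le_one_of_one_le₀ ?_
  rw [Real.norm_of_nonneg (by positivity)]
  exact le_add_of_nonneg_right (sq_nonneg _)

theorem tendsto_arctanSpike : Tendsto (fun n => arctanSpike k n s) atTop (𝓝 0) := by
  refine squeeze_zero_norm (a := fun n : ℕ => 1 / (n + 1 : ℝ) * Real.pi) (fun n => ?_)
    (by simpa using tendsto_one_div_add_atTop_nhds_zero_nat.mul_const Real.pi)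
  rw [arctanSpike, norm_mul, norm_inv, Real.norm_of_nonneg (by positivity), one_div]
  gcongr
  rw [Real.norm_eq_abs, abs_le]
  constructor <;>
    linarith [Real.arctan_lt_pi_div_two ((n + 1) * (s - k)),
      Real.neg_pi_div_two_lt_arctan ((n + 1) * (s - k)),
      Real.arctan_lt_pi_div_two ((n + 1) * (0 - k)),
      Real.neg_pi_div_two_lt_arctan ((n + 1) * (0 - k))]

theorem tendsto_deriv_arctanSpike :
    Tendsto (fun n => deriv (arctanSpike k n) s) atTop (𝓝 (({k} : Set ℝ).indicator 1 s)) := by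
  simp only [deriv_arctanSpike]
  obtain rfl | hs := eq_or_ne s k
  · simp
  · rw [indicator_of_notMem (by simpa using hs)]
    refine tendsto_inv_atTop_zero.comp (tendsto_atTop_add_const_left _ _ ?_)
    have hpos : 0 < (s - k) ^ 2 := by
      have := sub_ne_zero.2 hs
      positivity
    simp only [mul_pow]
    exact ((tendsto_pow_atTop two_ne_zero).comp (tendsto_atTop_add_const_right _ _
      tendsto_natCast_atTop_atTop)).atTop_mul_const hpos

end ArctanSpike

theorem HasWeakFDeriv.ae_eq_zero_of_eq (hw : HasWeakFDeriv Ω u g) (hΩ : IsOpen Ω)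
    (hu : IntegrableOn u Ω) (hg : IntegrableOn g Ω) (k : ℝ) :
    ∀ᵐ x ∂volume.restrict Ω, u x = k → g x = 0 := by
  set χ : ℝ → ℝ := ({k} : Set ℝ).indicator 1
  have hχ₁ : ∀ s, ‖χ s‖ ≤ 1 := fun s =>
    (norm_indicator_le_norm_self _ _).trans norm_one.le
  have hχu : AEStronglyMeasurable (fun x => χ (u x)) (volume.restrict Ω) :=
    ((measurable_one.indicator (measurableSet_singleton k)).comp_aemeasurable
      hu.aemeasurable).aestronglyMeasurable
  have hGu : ∀ n, IntegrableOn (fun x => arctanSpike k n (u x)) Ω := fun n =>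
    memLp_one_iff_integrable.1 <| (lipschitzWith_arctanSpike k n).comp_memLp (by simp [arctanSpike])
      (memLp_one_iff_integrable.2 hu)
  have hG'₁ : ∀ n s, ‖deriv (arctanSpike k n) s‖ ≤ 1 := fun n s =>
    norm_deriv_le_of_lipschitz (lipschitzWith_arctanSpike k n)
  have hG'u : ∀ n, AEStronglyMeasurable (fun x => deriv (arctanSpike k n) (u x))
      (volume.restrict Ω) := fun n =>
    ((contDiff_arctanSpike k n).continuous_deriv le_rfl).comp_aestronglyMeasurable
      hu.aestronglyMeasurable
  have hzero : HasWeakFDeriv Ω (fun _ => 0) (fun x => χ (u x) • g x) := by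
    refine hasWeakFDeriv_of_tendsto hGu
      (fun n => hg.bdd_smul 1 (hG'u n) (.of_forall fun x => hG'₁ n _))
      aestronglyMeasurable_const (hχu.smul hg.aestronglyMeasurable) ?_
      (tendsto_eLpNorm_smul_sub_smul one_ne_zero ENNReal.one_ne_top hG'u hχu (fun n x => hG'₁ n _)
        (fun x => hχ₁ _) (.of_forall fun x => tendsto_deriv_arctanSpike k (u x))
        (memLp_one_iff_integrable.2 hg))
      fun φ hφ hφs hφΩ y => .of_forall fun n => hw.comp_lipschitz hΩ hu hg
        (contDiff_arctanSpike k n) (lipschitzWith_arctanSpike k n) φ hφ hφs hφΩ y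
    refine tendsto_eLpNorm_zero_of_dominated one_ne_zero ENNReal.one_ne_top (g := u)
      (fun n => (hGu n).aestronglyMeasurable.sub aestronglyMeasurable_const) (fun n x => ?_)
      (memLp_one_iff_integrable.2 hu) (.of_forall fun x => ?_)
    · simpa [arctanSpike] using (lipschitzWith_arctanSpike k n).norm_sub_le (u x) 0
    · simpa using tendsto_arctanSpike k (u x)
  filter_upwards [ae_eq_zero_of_hasWeakFDeriv_zero hΩ
    (hg.bdd_smul 1 hχu (.of_forall fun x => hχ₁ _)) hzero] with x hx hk
  simpa [χ, hk] using hx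

end WeakDerivative

theorem ae_eq_const_of_locally_ae_eq_const {X Y : Type*} [TopologicalSpace X]
    [SecondCountableTopology X] [MeasurableSpace X] [OpensMeasurableSpace X] {μ : Measure X}
    [μ.IsOpenPosMeasure] {Ω : Set X} {u : X → Y} (hΩ : IsOpen Ω) (hconn : IsConnected Ω)
    (hloc : ∀ x ∈ Ω, ∃ U, IsOpen U ∧ x ∈ U ∧ ∃ k, ∀ᵐ z ∂μ, z ∈ U → u z = k) :
    ∃ k, ∀ᵐ x ∂μ.restrict Ω, u x = k := by
  obtain ⟨x₀, hx₀⟩ := hconn.nonempty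
  have : Nonempty Y := ⟨u x₀⟩
  choose! U hU hxU K hK using hloc
  have hKeq : ∀ x ∈ Ω, ∀ y ∈ Ω, K x = K y := by
    intro x hx y hy
    refine hconn.isPreconnected.induction₂ (fun x y => K x = K y) (fun x hx => ?_)
      (fun _ _ _ _ _ _ => Eq.trans) (fun _ _ _ _ => Eq.symm) hx hy
    filter_upwards [mem_nhdsWithin_of_mem_nhds ((hU x hx).mem_nhds (hxU x hx)),
      self_mem_nhdsWithin] with y hy hyΩ
    by_contra hne
    have hpos := ((hU x hx).inter (hU y hyΩ)).measure_pos μ ⟨y, hy, hxU y hyΩ⟩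
    refine hpos.ne' (measure_mono_null (fun z hz => ?_) ((hK x hx).and (hK y hyΩ)))
    exact fun h => hne ((h.1 hz.1).symm.trans (h.2 hz.2))
  refine ⟨K x₀, ?_⟩
  rw [ae_restrict_iff' hΩ.measurableSet, ae_iff]
  refine measure_null_of_locally_null _ fun x hx => ?_
  simp only [Classical.not_imp, mem_ofPred_eq] at hx
  refine ⟨_ ∩ _, inter_mem (mem_nhdsWithin_of_mem_nhds ((hU x hx.1).mem_nhds (hxU x hx.1)))
    self_mem_nhdsWithin, measure_mono_null (fun z hz => ?_) (hK x hx.1)⟩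
  exact fun hzK => hz.2 fun _ => (hzK hz.1).trans (hKeq x hx.1 x₀ hx₀)

section ZeroWeakDerivative

variable {V : Type*} [NormedAddCommGroup V] [NormedSpace ℝ V] [MeasureSpace V] {Ω : Set V}
  {u : V → ℝ}

theorem HasWeakFDeriv.congr_ae {g g' : V → V →L[ℝ] ℝ} (hw : HasWeakFDeriv Ω u g)
    (h : g =ᵐ[volume.restrict Ω] g') : HasWeakFDeriv Ω u g' := by
  intro φ hφ hφs hφΩ y
  rw [hw φ hφ hφs hφΩ y]
  congr 1
  refine integral_congr_ae ?_
  filter_upwards [h] with x hx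
  rw [hx]

variable [FiniteDimensional ℝ V] [BorelSpace V] [(volume : Measure V).IsAddHaarMeasure]

theorem HasWeakFDeriv.ae_eq_const_on_ball (hw : HasWeakFDeriv Ω u (fun _ => 0))
    (hΩ : MeasurableSet Ω) (hu : IntegrableOn u Ω) {x : V} {r : ℝ} (hr : 0 < r)
    (hrΩ : Metric.ball x (2 * r) ⊆ Ω) : ∃ k, ∀ᵐ z, z ∈ Metric.ball x r → u z = k := by
  have hsub : Metric.ball x r ⊆ Ω := (Metric.ball_subset_ball (by linarith)).trans hrΩ
  have hconst : ∀ᶠ n in atTop, ∀ z ∈ Metric.ball x r, ∀ z' ∈ Metric.ball x r,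
      mollify (bump V n) Ω u z = mollify (bump V n) Ω u z' := by
    filter_upwards [(tendsto_rOut_bump V).eventually (gt_mem_nhds hr)] with n hn z hz z' hz'
    refine (convex_ball x r).is_const_of_fderivWithin_eq_zero (𝕜 := ℝ)
      ((contDiff_mollify hΩ hu _).differentiable one_ne_zero).differentiableOn
      (fun w hw' => ?_) hz hz'
    have hball : Metric.closedBall w (bump V n).rOut ⊆ Ω := by
      refine (Metric.closedBall_subset_ball' ?_).trans hrΩ
      linarith [Metric.mem_ball.1 hw']
    rw [fderivWithin_of_isOpen Metric.isOpen_ball hw',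
      (hw.hasFDerivAt_mollify hΩ hu (integrable_zero V (V →L[ℝ] ℝ) _) _ hball).fderiv]
    simp [mollify, convolution]
  have hlim : ∀ᵐ z, z ∈ Metric.ball x r →
      Tendsto (fun n => mollify (bump V n) Ω u z) atTop (𝓝 (u z)) := by
    filter_upwards [(ae_restrict_iff' hΩ).1 (ae_tendsto_mollify hΩ hu)] with z hz hzr
      using hz (hsub hzr)
  obtain ⟨z₀, hz₀, hlim₀⟩ := ((frequently_ae_mem_iff.2
    (Metric.measure_ball_pos volume x hr).ne').and_eventually hlim).exists
  refine ⟨u z₀, ?_⟩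
  filter_upwards [hlim] with z hz hzr
  refine tendsto_nhds_unique (hz hzr) ((hlim₀ hz₀).congr' ?_)
  filter_upwards [hconst] with n hn using hn z₀ hz₀ z hzr

theorem HasWeakFDeriv.exists_ae_eq_const (hw : HasWeakFDeriv Ω u (fun _ => 0)) (hΩ : IsOpen Ω)
    (hconn : IsConnected Ω) (hu : IntegrableOn u Ω) :
    ∃ k, ∀ᵐ x ∂volume.restrict Ω, u x = k := by
  refine ae_eq_const_of_locally_ae_eq_const hΩ hconn fun x hx => ?_
  obtain ⟨r, hr, hrΩ⟩ := Metric.isOpen_iff.1 hΩ x hx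
  refine ⟨Metric.ball x (r / 2), Metric.isOpen_ball, Metric.mem_ball_self (half_pos hr), ?_⟩
  exact hw.ae_eq_const_on_ball hΩ.measurableSet hu (half_pos hr)
    (by rwa [mul_div_cancel₀ r two_ne_zero])

end ZeroWeakDerivative

/-! ### Functions in `H¹` -/

theorem memLp_comp_of_lipschitzWith {α : Type*} [MeasurableSpace α] {μ : Measure α}
    [IsFiniteMeasure μ] {f : α → ℝ} {p : ℝ≥0∞} (hf : MemLp f p μ) {G : ℝ → ℝ} {C : NNReal}
    (hG : LipschitzWith C G) : MemLp (fun x => G (f x)) p μ := by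
  have hG₀ : LipschitzWith C fun s => G s - G 0 := fun a b => by simpa using hG a b
  simpa [Function.comp_def, Pi.add_def] using
    (hG₀.comp_memLp (sub_self _) hf).add (memLp_const (G 0))

theorem memLp_deriv_comp_smul {α F : Type*} [MeasurableSpace α] {μ : Measure α}
    [NormedAddCommGroup F] [NormedSpace ℝ F] {w : α → ℝ} {A : α → F} {p : ℝ≥0∞} {G : ℝ → ℝ}
    {C : NNReal} (hG : ContDiff ℝ 1 G) (hC : LipschitzWith C G) (hw : AEStronglyMeasurable w μ)
    (hA : MemLp A p μ) : MemLp (fun x => deriv G (w x) • A x) p μ := by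
  refine hA.of_le_mul (c := C) (((hG.continuous_deriv le_rfl).comp_aestronglyMeasurable hw).smul
    hA.aestronglyMeasurable) (.of_forall fun x => ?_)
  rw [norm_smul]
  gcongr
  exact norm_deriv_le_of_lipschitz hC

namespace IsH1

variable {Ω : Set E3} [IsFiniteMeasure (volume.restrict Ω)] {u : E3 → ℝ} {Du : E3 → E3}

theorem integrableOn (h : IsH1 Ω u Du) : IntegrableOn u Ω :=
  h.memLp.integrable one_le_two

theorem integrableOn_innerSL (h : IsH1 Ω u Du) : IntegrableOn (fun x => innerSL ℝ (Du x)) Ω :=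
  (innerSL ℝ).integrable_comp (h.memLp_grad.integrable one_le_two)

theorem comp_lipschitz (h : IsH1 Ω u Du) (hΩ : IsOpen Ω) {G : ℝ → ℝ} {C : NNReal}
    (hG : ContDiff ℝ 1 G) (hC : LipschitzWith C G) :
    IsH1 Ω (fun x => G (u x)) (fun x => deriv G (u x) • Du x) where
  memLp := memLp_comp_of_lipschitzWith h.memLp hC
  memLp_grad := memLp_deriv_comp_smul hG hC h.memLp.aestronglyMeasurable h.memLp_grad
  weak := by
    simpa only [map_smul] using
      h.weak.comp_lipschitz hΩ h.integrableOn h.integrableOn_innerSL hG hC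

theorem add {u' : E3 → ℝ} {Du' : E3 → E3} (h : IsH1 Ω u Du) (h' : IsH1 Ω u' Du') :
    IsH1 Ω (fun x => u x + u' x) (fun x => Du x + Du' x) where
  memLp := h.memLp.add h'.memLp
  memLp_grad := h.memLp_grad.add h'.memLp_grad
  weak := by
    simpa only [map_add] using h.weak.add h'.weak h.integrableOn h'.integrableOn
      h.integrableOn_innerSL h'.integrableOn_innerSL

theorem grad_eq_zero_of_eq (h : IsH1 Ω u Du) (hΩ : IsOpen Ω) (k : ℝ) :
    ∀ᵐ x ∂volume.restrict Ω, u x = k → Du x = 0 := by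
  filter_upwards [h.weak.ae_eq_zero_of_eq hΩ h.integrableOn h.integrableOn_innerSL k]
    with x hx hk
  exact norm_eq_zero.1 (by rw [← innerSL_apply_norm (𝕜 := ℝ), hx hk, norm_zero])

theorem exists_ae_eq_const (h : IsH1 Ω u Du) (hΩ : IsOpen Ω) (hconn : IsConnected Ω)
    (hD : ∀ᵐ x ∂volume.restrict Ω, Du x = 0) : ∃ k, ∀ᵐ x ∂volume.restrict Ω, u x = k := by
  refine (h.weak.congr_ae ?_).exists_ae_eq_const hΩ hconn h.integrableOn
  filter_upwards [hD] with x hx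
  rw [hx, map_zero]

end IsH1

/-! ### Distributional derivatives in time -/

theorem IsTimeTest.integral_primitive_mul_deriv {T : ℝ} (hT : 0 < T) {q ζ : ℝ → ℝ}
    (hζ : IsTimeTest T ζ) (hq : IntervalIntegrable q volume 0 T) :
    ∫ t in Ioo 0 T, (∫ s in (0 : ℝ)..t, q s) * deriv ζ t = -∫ t in Ioo 0 T, ζ t * q t := by
  obtain ⟨hζc, -, hζT⟩ := hζ
  have hζ₀ : ζ 0 = 0 := image_eq_zero_of_notMem_tsupport fun h => (hζT h).1.false
  have hζ₁ : ζ T = 0 := image_eq_zero_of_notMem_tsupport fun h => (hζT h).2.false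
  have hparts := (hq.absolutelyContinuousOnInterval_intervalIntegral (c := 0)
    (by simp)).integral_mul_deriv_eq_deriv_mul
      (hζc.of_le (by simp)).contDiffOn.absolutelyContinuousOnInterval
  have hderiv : ∫ t in (0 : ℝ)..T, deriv (fun t => ∫ s in (0 : ℝ)..t, q s) t * ζ t
      = ∫ t in (0 : ℝ)..T, ζ t * q t := by
    refine intervalIntegral.integral_congr_ae ?_
    filter_upwards [hq.ae_hasDerivAt_integral] with t ht htI
    rw [(ht (uIoc_subset_uIcc htI) 0 (by simp)).deriv, mul_comm]
  rwa [hderiv, hζ₀, hζ₁, mul_zero, mul_zero, sub_zero, zero_sub,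
    intervalIntegral.integral_of_le hT.le, intervalIntegral.integral_of_le hT.le,
    integral_Ioc_eq_integral_Ioo, integral_Ioc_eq_integral_Ioo] at hparts

theorem exists_eqOn_const_of_timeTest {T : ℝ} (hT : 0 < T) {M : ℝ → ℝ}
    (hM : ContinuousOn M (Icc 0 T))
    (h : ∀ ζ, IsTimeTest T ζ → ∫ t in Ioo 0 T, M t * deriv ζ t = 0) :
    ∃ k, ∀ t ∈ Icc 0 T, M t = k := by
  have hweak : HasWeakFDeriv (Ioo 0 T) M (fun _ => 0) := by
    intro ζ hζ hζs hζT y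
    have hy : ∀ t, M t * fderiv ℝ ζ t y = (M t * deriv ζ t) * y := fun t => by
      rw [fderiv_eq_smul_deriv, smul_eq_mul]
      ring
    simp only [hy, integral_mul_const, h ζ ⟨hζ, hζs, hζT⟩]
    simp
  obtain ⟨k, hk⟩ := hweak.exists_ae_eq_const isOpen_Ioo (isConnected_Ioo hT)
    ((hM.integrableOn_compact isCompact_Icc).mono_set Ioo_subset_Icc_self)
  refine ⟨k, Measure.eqOn_of_ae_eq (μ := volume) (by rwa [← restrict_Ioo_eq_restrict_Icc]) hM
    continuousOn_const ?_⟩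
  rw [interior_Icc, closure_Ioo hT.ne]

theorem sub_eq_neg_integral_of_timeTest {T : ℝ} (hT : 0 < T) {m q : ℝ → ℝ}
    (hm : ContinuousOn m (Icc 0 T)) (hq : IntegrableOn q (Ioo 0 T))
    (h : ∀ ζ, IsTimeTest T ζ →
      -(∫ t in Ioo 0 T, deriv ζ t * m t) + ∫ t in Ioo 0 T, ζ t * q t = 0)
    {a b : ℝ} (ha : a ∈ Icc 0 T) (hb : b ∈ Icc 0 T) : m b - m a = -∫ t in a..b, q t := by
  have hqI : IntervalIntegrable q volume 0 T :=
    (intervalIntegrable_iff_integrableOn_Ioo_of_le hT.le).2 hq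
  set Q : ℝ → ℝ := fun t => ∫ s in (0 : ℝ)..t, q s
  have hQ : ContinuousOn Q (Icc 0 T) := by
    simpa only [uIcc_of_le hT.le] using
      (hqI.absolutelyContinuousOnInterval_intervalIntegral (c := 0) (by simp)).continuousOn
  have hint : ∀ {f ζ : ℝ → ℝ}, ContinuousOn f (Icc 0 T) → IsTimeTest T ζ →
      IntegrableOn (fun t => f t * deriv ζ t) (Ioo 0 T) := fun hf hζ =>
    ((hf.mul (hζ.1.continuous_deriv (by simp)).continuousOn).integrableOn_compact
      isCompact_Icc).mono_set Ioo_subset_Icc_self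
  obtain ⟨k, hk⟩ := exists_eqOn_const_of_timeTest (M := fun t => m t + Q t) hT (hm.add hQ)
    fun ζ hζ => by
      simp only [add_mul]
      rw [integral_add (hint hm hζ) (hint hQ hζ), hζ.integral_primitive_mul_deriv hT hqI]
      simp only [mul_comm (m _)]
      linarith [h ζ hζ]
  have hab : Q b - Q a = ∫ t in a..b, q t := by
    refine intervalIntegral.integral_interval_sub_left (hqI.mono_set ?_) (hqI.mono_set ?_)
    · rw [uIcc_of_le hT.le, uIcc_of_le hb.1]
      exact Icc_subset_Icc_right hb.2
    · rw [uIcc_of_le hT.le, uIcc_of_le ha.1]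
      exact Icc_subset_Icc_right ha.2
  linear_combination hk b hb - hk a ha - hab

/-! ### Pairings with a time shift -/

theorem cylinder_eq_restrict (Ω : Set E3) (T : ℝ) :
    cylinder Ω T = volume.restrict (Ioo 0 T ×ˢ Ω) := by
  rw [cylinder, Measure.prod_restrict, Measure.volume_eq_prod]

theorem memLp_indicator_cylinder {F : Type*} [NormedAddCommGroup F] {p : ℝ≥0∞}
    {A : ℝ → E3 → F} {Ω : Set E3} {T : ℝ} (hΩ : MeasurableSet Ω)
    (hA : MemLp (fun p : ℝ × E3 => A p.1 p.2) p (cylinder Ω T)) :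
    MemLp ((Ioo 0 T ×ˢ Ω).indicator fun p => A p.1 p.2) p := by
  rwa [memLp_indicator_iff_restrict (measurableSet_Ioo.prod hΩ), ← cylinder_eq_restrict]

section TimeShift

variable {F : Type*} [NormedAddCommGroup F] [InnerProductSpace ℝ F] {p q : ℝ≥0∞}
  [p.HolderConjugate q]

section Holder

variable {α : Type*} [MeasurableSpace α] {μ : Measure α} {f g : α → F}

include p q in
theorem integrable_inner_of_memLp (hf : MemLp f p μ) (hg : MemLp g q μ) :
    Integrable (fun x => inner ℝ (f x) (g x)) μ :=
  memLp_one_iff_integrable.1 <| hf.of_bilin (inner ℝ) 1 hg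
    (hf.aestronglyMeasurable.inner hg.aestronglyMeasurable)
    (.of_forall fun x => by simpa using nnnorm_inner_le_nnnorm (𝕜 := ℝ) (f x) (g x))

theorem eLpNorm_inner_le (hf : AEStronglyMeasurable f μ) (hg : AEStronglyMeasurable g μ) :
    eLpNorm (fun x => inner ℝ (f x) (g x)) 1 μ ≤ eLpNorm f p μ * eLpNorm g q μ := by
  simpa using eLpNorm_le_eLpNorm_mul_eLpNorm_of_nnnorm (p := p) (q := q) hf hg (inner ℝ) 1
    (.of_forall fun x => by simpa using nnnorm_inner_le_nnnorm (𝕜 := ℝ) (f x) (g x))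

end Holder

variable {W : Type*} [NormedAddCommGroup W] [NormedSpace ℝ W] [FiniteDimensional ℝ W]
  [MeasurableSpace W] [BorelSpace W]

theorem tendsto_integral_inner_translate {μ : Measure W} [μ.IsAddHaarMeasure] {A B : W → F}
    (hp : p ≠ ⊤) (hA : MemLp A p μ) (hB : MemLp B q μ) :
    Tendsto (fun y => ∫ x, inner ℝ (A (x - y)) (B x) ∂μ) (𝓝 0)
      (𝓝 (∫ x, inner ℝ (A x) (B x) ∂μ)) := by
  have hAy : ∀ y, MemLp (fun x => A (x - y)) p μ := fun y =>
    hA.comp_measurePreserving (measurePreserving_sub_right μ y)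
  refine tendsto_integral_of_L1' _ (integrable_inner_of_memLp hA hB).aestronglyMeasurable
    (.of_forall fun y => integrable_inner_of_memLp (hAy y) hB) ?_
  have hlim := ENNReal.Tendsto.mul_const (b := eLpNorm B q μ)
    (tendsto_eLpNorm_translate_sub (ENNReal.HolderConjugate.one_le p q) hp hA)
    (.inr hB.eLpNorm_ne_top)
  rw [zero_mul] at hlim
  refine tendsto_of_tendsto_of_tendsto_of_le_of_le tendsto_const_nhds hlim
    (fun _ => zero_le) fun y => ?_
  simpa only [Pi.sub_def, inner_sub_left] using
    eLpNorm_inner_le ((hAy y).sub hA).aestronglyMeasurable hB.aestronglyMeasurable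

instance : (volume : Measure (ℝ × E3)).IsAddHaarMeasure :=
  inferInstanceAs ((volume : Measure ℝ).prod (volume : Measure E3)).IsAddHaarMeasure

/-- The pairing in `L²(Ω)` of `A` at time `s` with `B` at time `t`. -/
def pairing (Ω : Set E3) (A B : ℝ → E3 → F) (t s : ℝ) : ℝ :=
  ∫ x in Ω, inner ℝ (A s x) (B t x)

variable {Ω : Set E3} {A B : ℝ → E3 → F} {T : ℝ}

theorem integral_inner_indicator (hΩ : MeasurableSet Ω) (s t : ℝ) :
    ∫ x, inner ℝ ((Ioo 0 T ×ˢ Ω).indicator (fun p => A p.1 p.2) (s, x))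
        ((Ioo 0 T ×ˢ Ω).indicator (fun p => B p.1 p.2) (t, x))
      = (Ioo 0 T).indicator (fun t => (Ioo 0 T).indicator (pairing Ω A B t) s) t := by
  classical
  by_cases ht : t ∈ Ioo 0 T
  · by_cases hs : s ∈ Ioo 0 T
    · rw [indicator_of_mem ht, indicator_of_mem hs, pairing, ← integral_indicator hΩ]
      congr 1 with x
      by_cases hx : x ∈ Ω <;> simp [hx, hs.1, hs.2, ht.1, ht.2]
    · simp [indicator_apply, hs]
  · simp [indicator_apply, ht]

theorem integrable_pairing_timeShift (hΩ : MeasurableSet Ω)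
    (hA : MemLp (fun p : ℝ × E3 => A p.1 p.2) p (cylinder Ω T))
    (hB : MemLp (fun p : ℝ × E3 => B p.1 p.2) q (cylinder Ω T))
    (ν : Measure ℝ) [IsFiniteMeasure ν] :
    Integrable (fun z : ℝ × ℝ => (Ioo 0 T).indicator (pairing Ω A B z.2) (z.2 - z.1))
      (ν.prod (volume.restrict (Ioo 0 T))) := by
  have hshift : MeasurePreserving (fun z : ℝ × (ℝ × E3) => (z.1, z.2 - (z.1, 0)))
      (ν.prod volume) (ν.prod volume) :=
    (MeasurePreserving.id ν).skew_product (g := fun σ (p : ℝ × E3) => p - (σ, 0))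
      (by unfold Function.uncurry; fun_prop)
      (.of_forall fun σ => (measurePreserving_sub_right volume (σ, (0 : E3))).map_eq)
  have hint := integrable_inner_of_memLp
    (((memLp_indicator_cylinder hΩ hA).comp_snd ν).comp_measurePreserving hshift)
    ((memLp_indicator_cylinder hΩ hB).comp_snd ν)
  have hslice := ((measurePreserving_prodAssoc ν (volume : Measure ℝ)
    (volume : Measure E3)).integrable_comp_of_integrable hint).integral_prod_left
  have hprod : ν.prod (volume.restrict (Ioo 0 T))
      = (ν.prod volume).restrict (univ ×ˢ Ioo 0 T) := by
    rw [← Measure.prod_restrict, Measure.restrict_univ]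
  rw [hprod]
  refine hslice.restrict.congr ?_
  filter_upwards [ae_restrict_mem (MeasurableSet.univ.prod measurableSet_Ioo)] with z hz
  simpa [MeasurableEquiv.prodAssoc, indicator_of_mem hz.2] using
    integral_inner_indicator (T := T) (A := A) (B := B) hΩ (z.2 - z.1) z.2

theorem integrableOn_pairing_sub (hΩ : MeasurableSet Ω)
    (hA : MemLp (fun p : ℝ × E3 => A p.1 p.2) p (cylinder Ω T))
    (hB : MemLp (fun p : ℝ × E3 => B p.1 p.2) q (cylinder Ω T)) (σ : ℝ) :
    IntegrableOn (fun t => (Ioo 0 T).indicator (pairing Ω A B t) (t - σ)) (Ioo 0 T) := by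
  have hint := integrable_pairing_timeShift hΩ hA hB (Measure.dirac σ)
  rw [Measure.dirac_prod] at hint
  exact hint.comp_measurable measurable_prodMk_left

theorem tendsto_integral_pairing_timeShift (hΩ : MeasurableSet Ω) (hp : p ≠ ⊤)
    (hA : MemLp (fun p : ℝ × E3 => A p.1 p.2) p (cylinder Ω T))
    (hB : MemLp (fun p : ℝ × E3 => B p.1 p.2) q (cylinder Ω T)) :
    Tendsto (fun σ => ∫ t in Ioo 0 T, (Ioo 0 T).indicator (pairing Ω A B t) (t - σ)) (𝓝 0)
      (𝓝 (∫ p, inner ℝ (A p.1 p.2) (B p.1 p.2) ∂cylinder Ω T)) := by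
  have hA' := memLp_indicator_cylinder hΩ hA
  have hB' := memLp_indicator_cylinder hΩ hB
  have hlim := (tendsto_integral_inner_translate hp hA' hB').comp
    ((Continuous.prodMk_left (0 : E3)).tendsto' (0 : ℝ) 0 rfl)
  have htarget : ∫ p, inner ℝ (A p.1 p.2) (B p.1 p.2) ∂cylinder Ω T
      = ∫ p, inner ℝ ((Ioo 0 T ×ˢ Ω).indicator (fun p => A p.1 p.2) p)
          ((Ioo 0 T ×ˢ Ω).indicator (fun p => B p.1 p.2) p) := by
    rw [cylinder_eq_restrict, ← integral_indicator (measurableSet_Ioo.prod hΩ)]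
    refine integral_congr_ae (.of_forall fun p => ?_)
    by_cases hp : p ∈ Ioo 0 T ×ˢ Ω <;> simp [hp]
  rw [htarget]
  refine hlim.congr fun σ => ?_
  have hint := integrable_inner_of_memLp
    (hA'.comp_measurePreserving (measurePreserving_sub_right volume (σ, (0 : E3)))) hB'
  rw [Measure.volume_eq_prod] at hint
  rw [← integral_indicator measurableSet_Ioo]
  refine (integral_prod _ hint).trans (integral_congr_ae (.of_forall fun t => ?_))
  simp only [Function.comp_apply, Prod.mk_sub_mk, sub_zero]
  exact integral_inner_indicator hΩ (t - σ) t

end TimeShift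

/-! ### Backward increments -/

section BackwardIncrements

variable {E : ℝ → ℝ} {K : ℝ → ℝ → ℝ} {T h : ℝ}

theorem integral_backward_increment (hE : IntervalIntegrable E volume 0 T) (h₀ : 0 < h)
    (hT : h < T) :
    IntervalIntegrable (fun t => E (max (t - h) 0)) volume 0 T ∧
      ∫ t in (0 : ℝ)..T, (E t - E (max (t - h) 0)) = (∫ t in (T - h)..T, E t) - h * E 0 := by
  have hmid : T - h ∈ uIcc 0 T := by
    rw [uIcc_of_le (h₀.trans hT).le]
    exact ⟨by linarith, by linarith⟩
  have hE₁ : IntervalIntegrable E volume 0 (T - h) :=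
    hE.mono_set (uIcc_subset_uIcc left_mem_uIcc hmid)
  have hE₂ : IntervalIntegrable E volume (T - h) T :=
    hE.mono_set (uIcc_subset_uIcc hmid right_mem_uIcc)
  have hfrozen : ∀ t ∈ uIcc 0 h, E (max (t - h) 0) = E 0 := fun t ht => by
    rw [uIcc_of_le h₀.le] at ht
    rw [max_eq_right (by linarith [ht.2])]
  have hshift : ∀ t ∈ uIcc h T, E (max (t - h) 0) = E (t - h) := fun t ht => by
    rw [uIcc_of_le hT.le] at ht
    rw [max_eq_left (by linarith [ht.1])]
  have hi₁ : IntervalIntegrable (fun t => E (max (t - h) 0)) volume 0 h :=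
    (intervalIntegrable_const (c := E 0)).congr fun t ht => (hfrozen t (uIoc_subset_uIcc ht)).symm
  have hi₂ : IntervalIntegrable (fun t => E (max (t - h) 0)) volume h T := by
    have hE₁' : IntervalIntegrable (fun t => E (t - h)) volume h T := by
      simpa using hE₁.comp_sub_right h
    exact hE₁'.congr fun t ht => (hshift t (uIoc_subset_uIcc ht)).symm
  refine ⟨hi₁.trans hi₂, ?_⟩
  rw [intervalIntegral.integral_sub hE (hi₁.trans hi₂),
    ← intervalIntegral.integral_add_adjacent_intervals hi₁ hi₂,
    intervalIntegral.integral_congr hfrozen, intervalIntegral.integral_congr hshift,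
    intervalIntegral.integral_comp_sub_right (fun t => E t) h,
    ← intervalIntegral.integral_add_adjacent_intervals hE₁ hE₂]
  simp only [intervalIntegral.integral_const, sub_zero, sub_self, smul_eq_mul]
  ring

theorem integral_sub_le_of_backward_increment_le (hE : IntervalIntegrable E volume 0 T)
    (h₀ : 0 < h) (hT : h < T)
    (hK : Integrable (fun z : ℝ × ℝ => K z.1 z.2)
      ((volume.restrict (Ioc 0 h)).prod (volume.restrict (Ioo 0 T))))
    (hinc : ∀ᵐ t ∂volume.restrict (Ioo 0 T),
      E t - E (max (t - h) 0) ≤ -∫ σ in Ioc 0 h, K σ t) :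
    (∫ t in (T - h)..T, E t) - h * E 0 ≤ -∫ σ in Ioc 0 h, ∫ t in Ioo 0 T, K σ t := by
  obtain ⟨hEs, hsum⟩ := integral_backward_increment hE h₀ hT
  rw [← hsum, intervalIntegral.integral_of_le (h₀.trans hT).le, integral_Ioc_eq_integral_Ioo,
    integral_integral_swap hK, ← integral_neg]
  refine integral_mono_ae ?_ hK.integral_prod_right.neg hinc
  exact ((intervalIntegrable_iff_integrableOn_Ioo_of_le (h₀.trans hT).le).1 hE).sub
    ((intervalIntegrable_iff_integrableOn_Ioo_of_le (h₀.trans hT).le).1 hEs)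

theorem add_le_of_backward_increment_le (hT : 0 < T) (hE : IntervalIntegrable E volume 0 T)
    (hlsc : LowerSemicontinuousWithinAt E (Icc 0 T) T)
    (hK : ∀ h, 0 < h → Integrable (fun z : ℝ × ℝ => K z.1 z.2)
      ((volume.restrict (Ioc 0 h)).prod (volume.restrict (Ioo 0 T))))
    (hinc : ∀ h, 0 < h → ∀ᵐ t ∂volume.restrict (Ioo 0 T),
      E t - E (max (t - h) 0) ≤ -∫ σ in Ioc 0 h, K σ t)
    {r : ℝ} (hr : Tendsto (fun σ => ∫ t in Ioo 0 T, K σ t) (𝓝[>] 0) (𝓝 r)) :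
    E T + r ≤ E 0 := by
  refine le_of_forall_pos_le_add fun ε hε => ?_
  obtain ⟨δ, hδ, hδE⟩ := Metric.mem_nhdsWithin_iff.1 (hlsc (E T - ε / 2) (by linarith))
  obtain ⟨δ', hδ', hδr⟩ := mem_nhdsGT_iff_exists_Ioo_subset.1
    (hr.eventually (lt_mem_nhds (show r - ε / 2 < r by linarith)))
  obtain ⟨h, h₀, hh⟩ := exists_between (lt_min hT (lt_min hδ hδ'))
  obtain ⟨hhT, hhδ, hhδ'⟩ := lt_min_iff.1 hh |>.imp_right lt_min_iff.1
  have hlow : h * (E T - ε / 2) ≤ ∫ t in (T - h)..T, E t := by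
    have hmid : T - h ∈ uIcc 0 T := by
      rw [uIcc_of_le hT.le]
      exact ⟨by linarith, by linarith⟩
    have hmono := intervalIntegral.integral_mono_on (a := T - h) (b := T) (by linarith)
      (intervalIntegrable_const (c := E T - ε / 2))
      (hE.mono_set (uIcc_subset_uIcc hmid right_mem_uIcc)) fun t ht =>
        (hδE ⟨by rw [Metric.mem_ball, Real.dist_eq, abs_lt]; constructor <;> linarith [ht.1, ht.2],
          by linarith [ht.1], ht.2⟩).le
    rwa [intervalIntegral.integral_const, sub_sub_cancel, smul_eq_mul] at hmono
  have hrate : h * (r - ε / 2) ≤ ∫ σ in Ioc 0 h, ∫ t in Ioo 0 T, K σ t := by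
    have hmono := setIntegral_mono_on (integrableOn_const (C := r - ε / 2) (by simp))
      (hK h h₀).integral_prod_left measurableSet_Ioc fun σ hσ =>
        le_of_lt (hδr ⟨hσ.1, hσ.2.trans_lt hhδ'⟩)
    simpa [h₀.le] using hmono
  have hstep := integral_sub_le_of_backward_increment_le hE h₀ hhT (hK h h₀) (hinc h h₀)
  refine le_of_mul_le_mul_left ?_ h₀
  linarith

end BackwardIncrements

/-! ### The energy inequality -/

/-- A convex truncation function `Φ`: a `C²` convex function whose first two derivatives are
bounded, normalised by `|Φ'| ≤ 1`. -/
structure IsTruncation (Φ : ℝ → ℝ) : Prop where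
  contDiff : ContDiff ℝ 2 Φ
  lipschitz : LipschitzWith 1 Φ
  lipschitz_deriv : ∃ C, LipschitzWith C (deriv Φ)
  monotone_deriv : Monotone (deriv Φ)

namespace IsTruncation

variable {Φ : ℝ → ℝ}

theorem contDiff_deriv (h : IsTruncation Φ) : ContDiff ℝ 1 (deriv Φ) :=
  ((contDiff_succ_iff_deriv (n := 1)).1 h.contDiff).2.2

theorem abs_deriv_le_one (h : IsTruncation Φ) (s : ℝ) : |deriv Φ s| ≤ 1 :=
  norm_deriv_le_of_lipschitz h.lipschitz

theorem sub_le_deriv_mul_sub (h : IsTruncation Φ) (a b : ℝ) : Φ a - Φ b ≤ deriv Φ a * (a - b) := by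
  have hd : Differentiable ℝ Φ := h.contDiff.differentiable two_ne_zero
  have hconv := h.monotone_deriv.convexOn_univ_of_deriv hd
  rcases lt_trichotomy a b with hab | rfl | hab
  · have hslope := hconv.deriv_le_slope (mem_univ a) (mem_univ b) hab (hd a)
    rw [slope_def_field, le_div_iff₀ (sub_pos.2 hab)] at hslope
    linarith
  · simp
  · have hslope := hconv.slope_le_deriv (mem_univ b) (mem_univ a) hab (hd a)
    rw [slope_def_field, div_le_iff₀ (sub_pos.2 hab)] at hslope
    linarith

section Slices

variable {Ω : Set E3} [IsFiniteMeasure (volume.restrict Ω)] {v w : E3 → ℝ}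

theorem memLp_deriv_comp (h : IsTruncation Φ) (hv : MemLp v 2 (volume.restrict Ω)) :
    MemLp (fun x => deriv Φ (v x)) 2 (volume.restrict Ω) :=
  let ⟨_, hC⟩ := h.lipschitz_deriv
  memLp_comp_of_lipschitzWith hv hC

theorem integral_sub_le (h : IsTruncation Φ) (hv : MemLp v 2 (volume.restrict Ω))
    (hw : MemLp w 2 (volume.restrict Ω)) :
    (∫ x in Ω, Φ (v x)) - ∫ x in Ω, Φ (w x)
      ≤ (∫ x in Ω, v x * deriv Φ (v x)) - ∫ x in Ω, w x * deriv Φ (v x) := by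
  have hΦ : ∀ {z : E3 → ℝ}, MemLp z 2 (volume.restrict Ω) → IntegrableOn (fun x => Φ (z x)) Ω :=
    fun hz => (memLp_comp_of_lipschitzWith hz h.lipschitz).integrable one_le_two
  have hG : ∀ {z : E3 → ℝ}, MemLp z 2 (volume.restrict Ω) →
      IntegrableOn (fun x => z x * deriv Φ (v x)) Ω :=
    fun hz => hz.integrable_mul (h.memLp_deriv_comp hv)
  rw [← integral_sub (hΦ hv) (hΦ hw), ← integral_sub (hG hv) (hG hw)]
  refine integral_mono ((hΦ hv).sub (hΦ hw)) ((hG hv).sub (hG hw)) fun x => ?_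
  linarith [h.sub_le_deriv_mul_sub (v x) (w x)]

theorem lowerSemicontinuousWithinAt_integral (h : IsTruncation Φ) {u : ℝ → E3 → ℝ} {T t : ℝ}
    (hu : WeaklyContinuousL2 Ω T u) (ht : t ∈ Icc 0 T) :
    LowerSemicontinuousWithinAt (fun s => ∫ x in Ω, Φ (u s x)) (Icc 0 T) t := by
  intro y hy
  have hcont := hu.2 _ (h.memLp_deriv_comp (hu.1 t ht)) t ht
  have hclose := hcont.eventually (lt_mem_nhds (sub_lt_self _ (sub_pos.2 hy)))
  filter_upwards [hclose, self_mem_nhdsWithin] with s hs hsT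
  linarith [h.integral_sub_le (hu.1 t ht) (hu.1 s hsT)]

end Slices

end IsTruncation

theorem integral_timeShift_indicator (g : ℝ → ℝ) {T t h : ℝ} (ht : t ∈ Ioo 0 T) (hh : 0 ≤ h) :
    ∫ σ in Ioc 0 h, (Ioo 0 T).indicator g (t - σ) = ∫ s in (max (t - h) 0)..t, g s := by
  rw [← intervalIntegral.integral_of_le hh,
    intervalIntegral.integral_comp_sub_left (fun s => (Ioo 0 T).indicator g s), sub_zero,
    intervalIntegral.integral_of_le (by linarith),
    intervalIntegral.integral_of_le (max_le (by linarith) ht.1.le),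
    setIntegral_indicator measurableSet_Ioo]
  congr 2 with s
  simp only [mem_inter_iff, mem_Ioc, mem_Ioo, max_lt_iff]
  exact ⟨fun hs => ⟨⟨hs.1.1, hs.2.1⟩, hs.1.2⟩,
    fun hs => ⟨⟨hs.1.1, hs.2⟩, hs.1.2, hs.2.trans_lt ht.2⟩⟩

section TruncatedSolutions

variable {Ω : Set E3} {T κ : ℝ} {u : ℝ → E3 → ℝ} {Du : ℝ → E3 → E3} {f : ℝ → E3 → ℝ} {Φ : ℝ → ℝ}

theorem IsTruncation.memLp_deriv_deriv_smul (h : IsTruncation Φ) {α : Type*} [MeasurableSpace α]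
    {μ : Measure α} {w : α → ℝ} {A : α → E3} (hw : AEStronglyMeasurable w μ) (hA : MemLp A 2 μ) :
    MemLp (fun x => deriv (deriv Φ) (w x) • A x) 2 μ := by
  obtain ⟨C, hC⟩ := h.lipschitz_deriv
  exact memLp_deriv_comp_smul h.contDiff_deriv hC hw hA

/-- The pairing of `-κ Δu + f` at time `s` with the truncation `Φ'(u)` at time `t`. -/
def truncatedFlux (Ω : Set E3) (κ : ℝ) (u : ℝ → E3 → ℝ) (Du : ℝ → E3 → E3) (f : ℝ → E3 → ℝ)
    (Φ : ℝ → ℝ) (t s : ℝ) : ℝ :=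
  κ * pairing Ω Du (fun t x => deriv (deriv Φ) (u t x) • Du t x) t s
    + pairing Ω f (fun t x => deriv Φ (u t x)) t s

/-- `u` is a weakly continuous solution in `L²(0,T;H¹(Ω))` of `∂ₜu - κ Δu + f = 0` when tested,
for almost every time `t`, with the time-independent function `Φ'(u(t))`. -/
structure SolvesTruncated (Ω : Set E3) (T κ : ℝ) (u : ℝ → E3 → ℝ) (Du : ℝ → E3 → E3)
    (f : ℝ → E3 → ℝ) (Φ : ℝ → ℝ) : Prop where
  memL2H1 : MemL2H1 Ω T u Du
  weaklyContinuous : WeaklyContinuousL2 Ω T u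
  integrable_source : Integrable (fun p : ℝ × E3 => f p.1 p.2) (cylinder Ω T)
  sub_eq : ∀ᵐ t ∂volume.restrict (Ioo 0 T), ∀ a ∈ Icc 0 T, ∀ b ∈ Icc 0 T,
    (∫ x in Ω, u b x * deriv Φ (u t x)) - ∫ x in Ω, u a x * deriv Φ (u t x)
      = -∫ s in a..b, truncatedFlux Ω κ u Du f Φ t s

theorem cylinder_mono (Ω : Set E3) {s T : ℝ} (h : s ≤ T) : cylinder Ω s ≤ cylinder Ω T := by
  rw [cylinder_eq_restrict, cylinder_eq_restrict]
  exact Measure.restrict_mono (prod_mono (Ioo_subset_Ioo_right h) subset_rfl) le_rfl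

instance [IsFiniteMeasure (volume.restrict Ω)] : IsFiniteMeasure (cylinder Ω T) := by
  unfold cylinder
  infer_instance

namespace SolvesTruncated

theorem mono (h : SolvesTruncated Ω T κ u Du f Φ) {t : ℝ} (ht : t ≤ T) :
    SolvesTruncated Ω t κ u Du f Φ where
  memL2H1 :=
    { memLp := h.memL2H1.memLp.mono_measure (cylinder_mono Ω ht)
      memLp_grad := h.memL2H1.memLp_grad.mono_measure (cylinder_mono Ω ht)
      isH1 := ae_restrict_of_ae_restrict_of_subset (Ioo_subset_Ioo_right ht) h.memL2H1.isH1 }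
  weaklyContinuous :=
    ⟨fun s hs => h.weaklyContinuous.1 s (Icc_subset_Icc_right ht hs),
      fun φ hφ => (h.weaklyContinuous.2 φ hφ).mono (Icc_subset_Icc_right ht)⟩
  integrable_source := h.integrable_source.mono_measure (cylinder_mono Ω ht)
  sub_eq := by
    filter_upwards [ae_restrict_of_ae_restrict_of_subset (Ioo_subset_Ioo_right ht) h.sub_eq]
      with s hs a ha b hb
    exact hs a (Icc_subset_Icc_right ht ha) b (Icc_subset_Icc_right ht hb)

theorem of_timeTest [IsFiniteMeasure (volume.restrict Ω)] (hT : 0 < T) (hΦ : IsTruncation Φ)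
    (hu : MemL2H1 Ω T u Du) (hc : WeaklyContinuousL2 Ω T u)
    (hf : Integrable (fun p : ℝ × E3 => f p.1 p.2) (cylinder Ω T))
    (heq : ∀ᵐ t ∂volume.restrict (Ioo 0 T), ∀ ζ, IsTimeTest T ζ →
      -(∫ s in Ioo 0 T, deriv ζ s * ∫ x in Ω, u s x * deriv Φ (u t x))
        + ∫ s in Ioo 0 T, ζ s * (κ * (∫ x in Ω, inner ℝ (Du s x)
            (deriv (deriv Φ) (u t x) • Du t x)) + ∫ x in Ω, f s x * deriv Φ (u t x)) = 0) :
    SolvesTruncated Ω T κ u Du f Φ := by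
  refine ⟨hu, hc, hf, ?_⟩
  filter_upwards [heq, hu.isH1] with t ht htH a ha b hb
  have hψ := hΦ.memLp_deriv_comp htH.memLp
  have hDψ := hΦ.memLp_deriv_deriv_smul htH.memLp.aestronglyMeasurable htH.memLp_grad
  have hflux : truncatedFlux Ω κ u Du f Φ t = fun s => κ * (∫ x in Ω, inner ℝ (Du s x)
      (deriv (deriv Φ) (u t x) • Du t x)) + ∫ x in Ω, f s x * deriv Φ (u t x) := by
    ext s
    simp only [truncatedFlux, pairing, RCLike.inner_apply, conj_trivial, mul_comm]
  have hgrad : Integrable (fun p : ℝ × E3 =>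
      inner ℝ (Du p.1 p.2) (deriv (deriv Φ) (u t p.2) • Du t p.2)) (cylinder Ω T) :=
    integrable_inner_of_memLp hu.memLp_grad (hDψ.comp_snd _)
  have hsource : Integrable (fun p : ℝ × E3 => f p.1 p.2 * deriv Φ (u t p.2)) (cylinder Ω T) :=
    hf.mul_bdd (c := 1) hψ.aestronglyMeasurable.comp_snd
      (.of_forall fun p => hΦ.abs_deriv_le_one _)
  refine sub_eq_neg_integral_of_timeTest hT (hc.2 _ hψ) ?_ ?_ ha hb
  · rw [hflux]
    exact (hgrad.integral_prod_left.const_mul κ).add hsource.integral_prod_left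
  · rw [hflux]
    exact ht

theorem memLp_deriv_comp (h : SolvesTruncated Ω T κ u Du f Φ) (hΦ : IsTruncation Φ) :
    MemLp (fun p : ℝ × E3 => deriv Φ (u p.1 p.2)) ⊤ (cylinder Ω T) :=
  memLp_top_of_bound (hΦ.contDiff_deriv.continuous.comp_aestronglyMeasurable
    h.memL2H1.memLp.aestronglyMeasurable) 1 (.of_forall fun _ => hΦ.abs_deriv_le_one _)

theorem memLp_grad_deriv_comp (h : SolvesTruncated Ω T κ u Du f Φ) (hΦ : IsTruncation Φ) :
    MemLp (fun p : ℝ × E3 => deriv (deriv Φ) (u p.1 p.2) • Du p.1 p.2) 2 (cylinder Ω T) :=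
  hΦ.memLp_deriv_deriv_smul h.memL2H1.memLp.aestronglyMeasurable h.memL2H1.memLp_grad

theorem integrable_dissipation (h : SolvesTruncated Ω T κ u Du f Φ) (hΦ : IsTruncation Φ) :
    Integrable (fun p : ℝ × E3 => deriv (deriv Φ) (u p.1 p.2) * ‖Du p.1 p.2‖ ^ 2)
      (cylinder Ω T) := by
  simpa only [real_inner_smul_right, real_inner_self_eq_norm_sq] using
    integrable_inner_of_memLp h.memL2H1.memLp_grad (h.memLp_grad_deriv_comp hΦ)

section EnergyInequality

variable [IsFiniteMeasure (volume.restrict Ω)]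

theorem integrable_energy (h : SolvesTruncated Ω T κ u Du f Φ) (hΦ : IsTruncation Φ) :
    Integrable (fun p : ℝ × E3 => Φ (u p.1 p.2)) (cylinder Ω T) :=
  (memLp_comp_of_lipschitzWith h.memL2H1.memLp hΦ.lipschitz).integrable one_le_two

theorem energy_backward_increment_le (h : SolvesTruncated Ω T κ u Du f Φ) (hΦ : IsTruncation Φ)
    {τ : ℝ} (hτ : 0 < τ) : ∀ᵐ t ∂volume.restrict (Ioo 0 T),
      (∫ x in Ω, Φ (u t x)) - ∫ x in Ω, Φ (u (max (t - τ) 0) x)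
        ≤ -∫ σ in Ioc 0 τ, (Ioo 0 T).indicator (truncatedFlux Ω κ u Du f Φ t) (t - σ) := by
  filter_upwards [h.sub_eq, ae_restrict_mem measurableSet_Ioo] with t hEq ht
  have htT : t ∈ Icc 0 T := Ioo_subset_Icc_self ht
  have hτT : max (t - τ) 0 ∈ Icc 0 T :=
    ⟨le_max_right _ _, max_le (by linarith [ht.2]) (ht.1.trans ht.2).le⟩
  rw [integral_timeShift_indicator _ ht hτ.le, ← hEq _ hτT _ htT]
  exact hΦ.integral_sub_le (h.weaklyContinuous.1 t htT) (h.weaklyContinuous.1 _ hτT)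

theorem energy_inequality (h : SolvesTruncated Ω T κ u Du f Φ) (hΩ : MeasurableSet Ω) (hT : 0 < T)
    (hΦ : IsTruncation Φ) :
    (∫ x in Ω, Φ (u T x)) + (κ * (∫ p, deriv (deriv Φ) (u p.1 p.2) * ‖Du p.1 p.2‖ ^ 2
      ∂cylinder Ω T) + ∫ p, f p.1 p.2 * deriv Φ (u p.1 p.2) ∂cylinder Ω T)
      ≤ ∫ x in Ω, Φ (u 0 x) := by
  set A : ℝ → E3 → E3 := fun t x => deriv (deriv Φ) (u t x) • Du t x
  set B : ℝ → E3 → ℝ := fun t x => deriv Φ (u t x)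
  have hDu : MemLp (fun p : ℝ × E3 => Du p.1 p.2) 2 (cylinder Ω T) := h.memL2H1.memLp_grad
  have hA : MemLp (fun p : ℝ × E3 => A p.1 p.2) 2 (cylinder Ω T) := h.memLp_grad_deriv_comp hΦ
  have hf : MemLp (fun p : ℝ × E3 => f p.1 p.2) 1 (cylinder Ω T) :=
    memLp_one_iff_integrable.2 h.integrable_source
  have hB : MemLp (fun p : ℝ × E3 => B p.1 p.2) ⊤ (cylinder Ω T) := h.memLp_deriv_comp hΦ
  have hflux : ∀ t σ, (Ioo 0 T).indicator (truncatedFlux Ω κ u Du f Φ t) (t - σ)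
      = κ * (Ioo 0 T).indicator (pairing Ω Du A t) (t - σ)
        + (Ioo 0 T).indicator (pairing Ω f B t) (t - σ) := fun t σ => by
    by_cases hσ : t - σ ∈ Ioo 0 T <;> simp [hσ, truncatedFlux, A, B]
  refine add_le_of_backward_increment_le (E := fun t => ∫ x in Ω, Φ (u t x)) hT
    ((intervalIntegrable_iff_integrableOn_Ioo_of_le hT.le).2
      (h.integrable_energy hΦ).integral_prod_left)
    (hΦ.lowerSemicontinuousWithinAt_integral h.weaklyContinuous (right_mem_Icc.2 hT.le))
    (fun τ _ => ?_) (fun τ hτ => h.energy_backward_increment_le hΦ hτ) ?_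
  · simp only [hflux]
    exact ((integrable_pairing_timeShift hΩ hDu hA _).const_mul κ).add
      (integrable_pairing_timeShift hΩ hf hB _)
  · have hlim := ((tendsto_integral_pairing_timeShift hΩ ENNReal.ofNat_ne_top hDu hA).const_mul
      κ).add (tendsto_integral_pairing_timeShift hΩ ENNReal.one_ne_top hf hB)
    simp only [A, B, real_inner_smul_right, real_inner_self_eq_norm_sq, RCLike.inner_apply,
      conj_trivial, mul_comm (deriv Φ _)] at hlim
    refine (hlim.congr fun σ => ?_).mono_left nhdsWithin_le_nhds
    simp only [hflux]
    rw [integral_add ((integrableOn_pairing_sub hΩ hDu hA σ).const_mul κ)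
      (integrableOn_pairing_sub hΩ hf hB σ), integral_const_mul]

end EnergyInequality

end SolvesTruncated

end TruncatedSolutions

/-! ### Consequences of the energy inequality -/

theorem ae_prod_eq_zero_of_ae_ae {α β F : Type*} [MeasurableSpace α] [MeasurableSpace β]
    [NormedAddCommGroup F] {μ : Measure α} {ν : Measure β} [SFinite ν] {w : α × β → F}
    (hw : AEStronglyMeasurable w (μ.prod ν)) (h : ∀ᵐ a ∂μ, ∀ᵐ b ∂ν, w (a, b) = 0) :
    ∀ᵐ p ∂μ.prod ν, w p = 0 := by
  have hzero : ∫⁻ p, ‖w p‖ₑ ∂μ.prod ν = 0 := by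
    rw [lintegral_prod _ hw.enorm, lintegral_eq_zero_of_ae_eq_zero]
    filter_upwards [h] with a ha
    refine lintegral_eq_zero_of_ae_eq_zero ?_
    filter_upwards [ha] with b hb
    simp [hb]
  filter_upwards [(lintegral_eq_zero_iff' hw.enorm).1 hzero] with p hp
  simpa using hp

theorem IsTruncation.deriv_deriv_nonneg {Φ : ℝ → ℝ} (h : IsTruncation Φ) (s : ℝ) :
    0 ≤ deriv (deriv Φ) s :=
  h.monotone_deriv.deriv_nonneg

theorem IsTruncation.dissipation_nonneg {Φ : ℝ → ℝ} (h : IsTruncation Φ) (s : ℝ) (y : E3) :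
    0 ≤ deriv (deriv Φ) s * ‖y‖ ^ 2 :=
  mul_nonneg (h.deriv_deriv_nonneg s) (sq_nonneg _)

namespace SolvesTruncated

variable {Ω : Set E3} [IsFiniteMeasure (volume.restrict Ω)] {T κ : ℝ} {u : ℝ → E3 → ℝ}
  {Du : ℝ → E3 → E3} {f : ℝ → E3 → ℝ} {Φ : ℝ → ℝ}

theorem truncated_grad_eq_zero (h : SolvesTruncated Ω T κ u Du f Φ) (hΩ : MeasurableSet Ω)
    (hT : 0 < T) (hκ : 0 < κ) (hΦ : IsTruncation Φ)
    (hperiodic : ∫ x in Ω, Φ (u 0 x) ≤ ∫ x in Ω, Φ (u T x))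
    (hsource : 0 ≤ ∫ p, f p.1 p.2 * deriv Φ (u p.1 p.2) ∂cylinder Ω T) :
    ∀ᵐ p ∂cylinder Ω T, deriv (deriv Φ) (u p.1 p.2) • Du p.1 p.2 = 0 := by
  have henergy := h.energy_inequality hΩ hT hΦ
  have hdissipation : ∫ p, deriv (deriv Φ) (u p.1 p.2) * ‖Du p.1 p.2‖ ^ 2 ∂cylinder Ω T = 0 :=
    le_antisymm (nonpos_of_mul_nonpos_right (by linarith) hκ)
      (integral_nonneg fun _ => hΦ.dissipation_nonneg _ _)
  filter_upwards [(integral_eq_zero_iff_of_nonneg (fun _ => hΦ.dissipation_nonneg _ _)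
    (h.integrable_dissipation hΦ)).1 hdissipation] with p hp
  simpa using hp

theorem exists_deriv_comp_ae_eq_const (h : SolvesTruncated Ω T κ u Du f Φ) (hΩ : IsOpen Ω)
    (hconn : IsConnected Ω) (hT : 0 < T) (hκ : 0 < κ) (hΦ : IsTruncation Φ)
    (hperiodic : ∫ x in Ω, Φ (u 0 x) ≤ ∫ x in Ω, Φ (u T x))
    (hsource : 0 ≤ ∫ p, f p.1 p.2 * deriv Φ (u p.1 p.2) ∂cylinder Ω T) :
    ∀ᵐ t ∂volume.restrict (Ioo 0 T), ∃ a, ∀ᵐ x ∂volume.restrict Ω, deriv Φ (u t x) = a := by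
  have hgrad := h.truncated_grad_eq_zero hΩ.measurableSet hT hκ hΦ hperiodic hsource
  obtain ⟨C, hC⟩ := hΦ.lipschitz_deriv
  filter_upwards [Measure.ae_ae_of_ae_prod hgrad, h.memL2H1.isH1] with t ht htH
  exact (htH.comp_lipschitz hΩ hΦ.contDiff_deriv hC).exists_ae_eq_const hΩ hconn ht

theorem ae_comp_eq_zero (h : SolvesTruncated Ω T κ u Du f Φ) (hΩ : MeasurableSet Ω)
    (hκ : 0 ≤ κ) (hΦ : IsTruncation Φ) (hnonneg : ∀ s, 0 ≤ Φ s)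
    (hinit : ∀ᵐ x ∂volume.restrict Ω, Φ (u 0 x) = 0)
    (hsource : ∀ t ∈ Ioo 0 T, 0 ≤ ∫ p, f p.1 p.2 * deriv Φ (u p.1 p.2) ∂cylinder Ω t) :
    ∀ᵐ p ∂cylinder Ω T, Φ (u p.1 p.2) = 0 := by
  refine ae_prod_eq_zero_of_ae_ae (w := fun p : ℝ × E3 => Φ (u p.1 p.2))
    (h.integrable_energy hΦ).aestronglyMeasurable ?_
  filter_upwards [(h.integrable_energy hΦ).prod_right_ae, ae_restrict_mem measurableSet_Ioo]
    with t hint ht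
  have henergy := (h.mono ht.2.le).energy_inequality hΩ ht.1 hΦ
  rw [integral_eq_zero_of_ae hinit] at henergy
  have hdissipation : 0 ≤ κ * ∫ p, deriv (deriv Φ) (u p.1 p.2) * ‖Du p.1 p.2‖ ^ 2 ∂cylinder Ω t :=
    mul_nonneg hκ (integral_nonneg fun _ => hΦ.dissipation_nonneg _ _)
  refine (integral_eq_zero_iff_of_nonneg (fun _ => hnonneg _) hint).1
    (le_antisymm ?_ (integral_nonneg fun _ => hnonneg _))
  linarith [hsource t ht]

end SolvesTruncated

/-! ### Surface measure of the boundary -/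

section SurfaceMeasure

variable {E : Type*} [NormedAddCommGroup E] [NormedSpace ℝ E]

theorem exists_antilipschitzWith_prod_projection_ker [FiniteDimensional ℝ E]
    (L : E →L[ℝ] ℝ) : ∃ P : E →L[ℝ] L.ker, ∃ K > 0, AntilipschitzWith K (L.prod P) := by
  obtain ⟨P, hP⟩ := L.ker.subtype.exists_leftInverse_of_injective L.ker.ker_subtype
  obtain ⟨K, hK₀, hK⟩ := (L.toLinearMap.prod P).exists_antilipschitzWith <|
    LinearMap.ker_eq_bot'.2 fun x hx => by
      obtain ⟨hL, hPx⟩ := Prod.mk_eq_zero.1 hx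
      simpa [hPx] using (congrArg Subtype.val (LinearMap.congr_fun hP ⟨x, hL⟩)).symm
  exact ⟨P.toContinuousLinearMap, K, hK₀, hK⟩

theorem exists_antilipschitzWith_domRestrict_zeroSet [FiniteDimensional ℝ E] {f : E → ℝ}
    {f' : E →L[ℝ] ℝ} {x₀ : E} (hf : HasStrictFDerivAt f f' x₀) :
    ∃ P : E →L[ℝ] f'.ker, ∃ K, ∃ V ∈ 𝓝 x₀,
      AntilipschitzWith K ((V ∩ f ⁻¹' {0}).domRestrict P) := by
  obtain ⟨P, K, hK₀, hK⟩ := exists_antilipschitzWith_prod_projection_ker f'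
  have hlittle := hf.isLittleO.def (c := 1 / (2 * K)) (by positivity)
  rw [nhds_prod_eq] at hlittle
  obtain ⟨V, hV, hfV⟩ := (eventually_prod_self_iff
    (r := fun x y => ‖f x - f y - f' (x - y)‖ ≤ 1 / (2 * K) * ‖x - y‖)).1 hlittle
  refine ⟨P, K, V, hV, .of_le_mul_dist ?_⟩
  rintro ⟨x, hx, hfx : f x = 0⟩ ⟨y, hy, hfy : f y = 0⟩
  have hL : ‖f' (x - y)‖ ≤ 1 / (2 * K) * ‖x - y‖ := by
    simpa only [hfx, hfy, sub_self, zero_sub, norm_neg] using hfV x hx y hy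
  have hanti : ‖x - y‖ ≤ K * max ‖f' (x - y)‖ ‖P (x - y)‖ := by
    simpa [dist_eq_norm, Prod.norm_def] using hK.le_mul_dist x y
  simp only [Subtype.dist_eq, domRestrict_apply, dist_eq_norm, ← map_sub]
  rcases le_total ‖f' (x - y)‖ ‖P (x - y)‖ with h | h
  · rwa [max_eq_right h] at hanti
  · have hhalf : ‖x - y‖ ≤ 1 / 2 * ‖x - y‖ := calc
      ‖x - y‖ ≤ K * (1 / (2 * K) * ‖x - y‖) := by
        rw [max_eq_left h] at hanti
        exact hanti.trans (mul_le_mul_of_nonneg_left hL K.2)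
      _ = 1 / 2 * ‖x - y‖ := by field_simp
    have hzero : ‖x - y‖ ≤ 0 := by linarith
    exact hzero.trans (by positivity)

variable [MeasurableSpace E] [BorelSpace E]

theorem hausdorffMeasure_lt_top_of_antilipschitz {F : Type*} [NormedAddCommGroup F]
    [NormedSpace ℝ F] [FiniteDimensional ℝ F] [MeasurableSpace F] [BorelSpace F] {s : Set E}
    (hs : Bornology.IsBounded s) {P : E →L[ℝ] F} {K : NNReal}
    (hP : AntilipschitzWith K (s.domRestrict P)) : μH[Module.finrank ℝ F] s < ⊤ := by
  have himage : s.domRestrict P '' univ = P '' s := by rw [image_univ, range_domRestrict]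
  have hsub := (isometry_subtype_coe (s := s)).hausdorffMeasure_image
    (d := Module.finrank ℝ F) (.inl (Nat.cast_nonneg _)) univ
  rw [image_univ, Subtype.range_coe] at hsub
  rw [hsub]
  refine (hP.le_hausdorffMeasure_image (Nat.cast_nonneg _) univ).trans_lt (ENNReal.mul_lt_top
    (ENNReal.rpow_lt_top_of_nonneg (Nat.cast_nonneg _) ENNReal.coe_ne_top) ?_)
  rw [himage]
  exact (P.lipschitz.isBounded_image hs).measure_lt_top

theorem exists_hausdorffMeasure_zeroSet_lt_top [FiniteDimensional ℝ E] {f : E → ℝ}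
    {f' : E →L[ℝ] ℝ} {x₀ : E} (hf : HasStrictFDerivAt f f' x₀) (hf' : f' ≠ 0) {d : ℕ}
    (hd : Module.finrank ℝ E = d + 1) :
    ∃ V ∈ 𝓝 x₀, μH[d] (V ∩ f ⁻¹' {0}) < ⊤ := by
  obtain ⟨P, K, V, hV, hP⟩ := exists_antilipschitzWith_domRestrict_zeroSet hf
  have hker : Module.finrank ℝ f'.ker = d := by
    have := Module.Dual.finrank_ker_add_one_of_ne_zero (f := f'.toLinearMap)
      fun h => hf' (ContinuousLinearMap.coe_injective h)
    omega
  refine ⟨V ∩ Metric.ball x₀ 1, inter_mem hV (Metric.ball_mem_nhds _ one_pos), ?_⟩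
  rw [← hker]
  refine hausdorffMeasure_lt_top_of_antilipschitz (P := P) (K := K)
    (Metric.isBounded_ball.subset fun x hx => hx.1.2) ?_
  exact fun x y => hP ⟨x, x.2.1.1, x.2.2⟩ ⟨y, y.2.1.1, y.2.2⟩

end SurfaceMeasure

theorem IsLocalDefiningFunction.eq_zero_of_mem_frontier {Ω U : Set E3} {x₀ x : E3} {f : E3 → ℝ}
    (h : IsLocalDefiningFunction Ω x₀ U f) (hΩ : IsOpen Ω) (hx : x ∈ frontier Ω) (hxU : x ∈ U) :
    f x = 0 := by
  have hU := h.isOpen.mem_nhds hxU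
  rw [hΩ.frontier_eq] at hx
  refine le_antisymm (not_lt.1 fun hpos => ?_) (not_lt.1 fun hneg => ?_)
  · have hcont := h.contDiffOn.continuousOn.continuousAt hU
    obtain ⟨y, ⟨hy, hyU⟩, hyΩ⟩ :=
      mem_closure_iff_nhds.1 hx.1 _ (inter_mem (hcont.eventually (lt_mem_nhds hpos)) hU)
    have hyneg : y ∈ {x ∈ U | f x < 0} := h.inter_eq ▸ ⟨hyU, hyΩ⟩
    exact lt_asymm hy hyneg.2
  · have hxΩ : x ∈ U ∩ Ω := h.inter_eq ▸ ⟨hxU, hneg⟩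
    exact hx.2 hxΩ.2

theorem surf_frontier_lt_top {Ω : Set E3} (hΩ : IsOpen Ω) (hb : Bornology.IsBounded Ω)
    (h : HasC2Boundary Ω) : surf (frontier Ω) < ⊤ := by
  have hcompact : IsCompact (frontier Ω) := Metric.isCompact_of_isClosed_isBounded isClosed_frontier
    (hb.closure.subset frontier_subset_closure)
  refine hcompact.measure_lt_top_of_nhdsWithin fun x₀ hx₀ => ?_
  obtain ⟨U, f, hf⟩ := h x₀ hx₀
  have hU := hf.isOpen.mem_nhds hf.mem
  have hne : fderiv ℝ f x₀ ≠ 0 := fun h₀ => hf.gradient_ne_zero (by simp [gradient, h₀])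
  obtain ⟨V, hV, hVlt⟩ := exists_hausdorffMeasure_zeroSet_lt_top
    ((hf.contDiffOn.contDiffAt hU).hasStrictFDerivAt two_ne_zero) hne (d := 2) (by simp)
  refine ⟨V ∩ U ∩ frontier Ω,
    inter_mem (mem_nhdsWithin_of_mem_nhds (inter_mem hV hU)) self_mem_nhdsWithin, ?_⟩
  refine (measure_mono fun x hx => ?_).trans_lt hVlt
  exact ⟨hx.1.1, hf.eq_zero_of_mem_frontier hΩ hx.2 hx.1.2⟩

/-! ### Calculus of traces -/

theorem continuous_gradient {E : Type*} [NormedAddCommGroup E] [InnerProductSpace ℝ E]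
    [CompleteSpace E] {φ : E → ℝ} (hφ : ContDiff ℝ 1 φ) : Continuous (gradient φ) :=
  (InnerProductSpace.toDual ℝ E).symm.continuous.comp (hφ.continuous_fderiv one_ne_zero)

namespace HasTrace

variable {Ω : Set E3} [IsFiniteMeasure (volume.restrict Ω)] {u τ : E3 → ℝ} {Du : E3 → E3}

theorem add {u' τ' : E3 → ℝ} {Du' : E3 → E3} (h : HasTrace Ω u Du τ)
    (h' : HasTrace Ω u' Du' τ') :
    HasTrace Ω (fun x => u x + u' x) (fun x => Du x + Du' x) (fun x => τ x + τ' x) := by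
  obtain ⟨hu, hτ, φ, hφ, hφu, hφDu, hφτ⟩ := h
  obtain ⟨hu', hτ', ψ, hψ, hψu, hψDu, hψτ⟩ := h'
  have hφm : ∀ μ n, AEStronglyMeasurable (φ n) μ := fun _ n =>
    (hφ n).continuous.aestronglyMeasurable
  have hψm : ∀ μ n, AEStronglyMeasurable (ψ n) μ := fun _ n =>
    (hψ n).continuous.aestronglyMeasurable
  have hgradient : ∀ n x, gradient (fun x => φ n x + ψ n x) x
      = gradient (φ n) x + gradient (ψ n) x := fun n x => by
    rw [gradient, fderiv_fun_add ((hφ n).differentiable one_ne_zero x)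
      ((hψ n).differentiable one_ne_zero x), map_add, gradient, gradient]
  refine ⟨hu.add hu', hτ.add hτ', fun n x => φ n x + ψ n x, fun n => (hφ n).add (hψ n),
    tendsto_eLpNorm_add_sub one_le_two (hφm _) (hψm _) hu.memLp.aestronglyMeasurable
      hu'.memLp.aestronglyMeasurable hφu hψu, ?_,
    tendsto_eLpNorm_add_sub one_le_two (hφm _) (hψm _) hτ.aestronglyMeasurable
      hτ'.aestronglyMeasurable hφτ hψτ⟩
  simp only [hgradient]
  exact tendsto_eLpNorm_add_sub one_le_two
    (fun n => (continuous_gradient (hφ n)).aestronglyMeasurable)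
    (fun n => (continuous_gradient (hψ n)).aestronglyMeasurable)
    hu.memLp_grad.aestronglyMeasurable hu'.memLp_grad.aestronglyMeasurable hφDu hψDu

theorem comp_lipschitz [IsFiniteMeasure (surf.restrict (frontier Ω))] (h : HasTrace Ω u Du τ)
    (hΩ : IsOpen Ω) {G : ℝ → ℝ} {C : NNReal} (hG : ContDiff ℝ 1 G) (hC : LipschitzWith C G) :
    HasTrace Ω (fun x => G (u x)) (fun x => deriv G (u x) • Du x) (fun x => G (τ x)) := by
  obtain ⟨hu, hτ, φ, hφ, hφu, hφDu, hφτ⟩ := h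
  obtain ⟨k, hk, hae⟩ := (tendstoInMeasure_of_tendsto_eLpNorm two_ne_zero
    (fun n => (hφ n).continuous.aestronglyMeasurable) hu.memLp.aestronglyMeasurable
    hφu).exists_seq_tendsto_ae
  have hG' := hG.continuous_deriv le_rfl
  have hgradient : ∀ n x, gradient (fun x => G (φ n x)) x
      = deriv G (φ n x) • gradient (φ n) x := fun n x => by
    have hcomp := (hG.differentiable one_ne_zero (φ n x)).hasDerivAt.comp_hasFDerivAt x
      ((hφ n).differentiable one_ne_zero x).hasFDerivAt
    have hfderiv : fderiv ℝ (fun x => G (φ n x)) x = deriv G (φ n x) • fderiv ℝ (φ n) x :=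
      hcomp.fderiv
    rw [gradient, hfderiv, map_smul, gradient]
  refine ⟨hu.comp_lipschitz hΩ hG hC, memLp_comp_of_lipschitzWith hτ hC,
    fun n x => G (φ (k n) x), fun n => hG.comp (hφ (k n)),
    tendsto_eLpNorm_comp_sub hC (hφu.comp hk.tendsto_atTop), ?_,
    tendsto_eLpNorm_comp_sub hC (hφτ.comp hk.tendsto_atTop)⟩
  simp only [hgradient]
  refine tendsto_eLpNorm_smul_sub (C := C) one_le_two ENNReal.ofNat_ne_top
    (fun n => (hG'.comp (hφ (k n)).continuous).aestronglyMeasurable)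
    (hG'.comp_aestronglyMeasurable hu.memLp.aestronglyMeasurable)
    (fun _ _ => norm_deriv_le_of_lipschitz hC) (fun _ => norm_deriv_le_of_lipschitz hC) ?_
    (fun n => (continuous_gradient (hφ (k n))).aestronglyMeasurable) hu.memLp_grad
    (hφDu.comp hk.tendsto_atTop)
  filter_upwards [hae] with x hx using (hG'.tendsto _).comp hx

end HasTrace

/-! ### One-sided truncations -/

theorem exists_lipschitzWith_smoothTransition : ∃ C, LipschitzWith C Real.smoothTransition := by
  obtain ⟨C, hC⟩ := (Real.smoothTransition.contDiff (n := 1)).contDiffOn.exists_lipschitzOnWith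
    one_ne_zero (convex_Icc 0 1) isCompact_Icc
  refine ⟨C, fun s r => ?_⟩
  rw [← Real.smoothTransition.projIcc (x := s), ← Real.smoothTransition.projIcc (x := r)]
  have hproj := LipschitzWith.projIcc zero_le_one s r
  rw [ENNReal.coe_one, one_mul] at hproj
  exact (hC (projIcc _ _ _ s).2 (projIcc _ _ _ r).2).trans (mul_le_mul_right hproj _)

/-- A smoothing of the positive part: a nonnegative convex function which vanishes exactly on
`(-∞, 0]` and has slope at most one. -/
def smoothPosPart (s : ℝ) : ℝ := ∫ r in (0 : ℝ)..s, Real.smoothTransition r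

theorem deriv_smoothPosPart : deriv smoothPosPart = Real.smoothTransition :=
  funext fun s => Real.smoothTransition.continuous.deriv_integral _ 0 s

theorem smoothPosPart_eq_zero {s : ℝ} (hs : s ≤ 0) : smoothPosPart s = 0 := by
  rw [smoothPosPart, intervalIntegral.integral_congr (g := fun _ => 0) fun r hr => ?_]
  · simp
  · rw [uIcc_of_ge hs] at hr
    exact Real.smoothTransition.zero_of_nonpos hr.2

theorem smoothPosPart_pos {s : ℝ} (hs : 0 < s) : 0 < smoothPosPart s :=
  intervalIntegral.intervalIntegral_pos_of_pos_on
    (Real.smoothTransition.continuous.intervalIntegrable _ _)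
    (fun _ hr => Real.smoothTransition.pos_of_pos hr.1) hs

theorem smoothPosPart_eq_zero_iff {s : ℝ} : smoothPosPart s = 0 ↔ s ≤ 0 :=
  ⟨fun h => not_lt.1 fun hs => (smoothPosPart_pos hs).ne' h, smoothPosPart_eq_zero⟩

theorem smoothPosPart_nonneg (s : ℝ) : 0 ≤ smoothPosPart s :=
  (le_or_gt s 0).elim (fun hs => (smoothPosPart_eq_zero hs).ge) fun hs => (smoothPosPart_pos hs).le

theorem differentiable_smoothPosPart : Differentiable ℝ smoothPosPart := fun s =>
  (Real.smoothTransition.continuous.integral_hasStrictDerivAt 0 s).hasDerivAt.differentiableAt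

theorem isTruncation_smoothPosPart : IsTruncation smoothPosPart where
  contDiff := by
    refine (contDiff_succ_iff_deriv (n := 1)).2 ⟨differentiable_smoothPosPart, by simp, ?_⟩
    rw [deriv_smoothPosPart]
    exact Real.smoothTransition.contDiff
  lipschitz := by
    refine lipschitzWith_of_nnnorm_deriv_le differentiable_smoothPosPart fun s => ?_
    rw [deriv_smoothPosPart, ← NNReal.coe_le_coe, coe_nnnorm, Real.norm_eq_abs,
      abs_of_nonneg (Real.smoothTransition.nonneg s)]
    exact Real.smoothTransition.le_one s
  lipschitz_deriv := deriv_smoothPosPart ▸ exists_lipschitzWith_smoothTransition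
  monotone_deriv := deriv_smoothPosPart ▸ Real.smoothTransition.monotone

theorem IsTruncation.comp_sub_const {Φ : ℝ → ℝ} (h : IsTruncation Φ) (M : ℝ) :
    IsTruncation fun s => Φ (s - M) where
  contDiff := h.contDiff.comp (contDiff_id.sub contDiff_const)
  lipschitz := fun s r => by simpa using h.lipschitz (s - M) (r - M)
  lipschitz_deriv := by
    obtain ⟨C, hC⟩ := h.lipschitz_deriv
    exact ⟨C, fun s r => by simpa [deriv_comp_sub_const] using hC (s - M) (r - M)⟩
  monotone_deriv := fun s r hsr => by
    simpa only [deriv_comp_sub_const] using h.monotone_deriv (sub_le_sub_right hsr M)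

theorem IsTruncation.comp_const_sub {Φ : ℝ → ℝ} (h : IsTruncation Φ) (M : ℝ) :
    IsTruncation fun s => Φ (M - s) where
  contDiff := h.contDiff.comp (contDiff_const.sub contDiff_id)
  lipschitz := fun s r => by simpa using h.lipschitz (M - s) (M - r)
  lipschitz_deriv := by
    obtain ⟨C, hC⟩ := h.lipschitz_deriv
    exact ⟨C, fun s r => by simpa [deriv_comp_const_sub] using hC (M - s) (M - r)⟩
  monotone_deriv := fun s r hsr => by
    simpa only [deriv_comp_const_sub, neg_le_neg_iff] using
      h.monotone_deriv (sub_le_sub_left hsr M)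

namespace PhaseDiagram

variable (P : PhaseDiagram)

theorem θE_mem : P.θE ∈ Icc P.θE P.θF := left_mem_Icc.2 P.θE_lt_θF.le

theorem θF_mem : P.θF ∈ Icc P.θE P.θF := right_mem_Icc.2 P.θE_lt_θF.le

theorem cE_pos : 0 < P.cE := by
  have h := P.strictAntiOn_γl P.θE_mem P.θF_mem P.θE_lt_θF
  rwa [P.γl_θF] at h

theorem cA_lt_cE : P.cA < P.cE := P.γs_lt_γl _ ⟨le_rfl, P.θE_lt_θF⟩

theorem closure_zones_subset :
    closure (P.zoneL ∪ P.zoneS ∪ P.zoneM) ⊆ {z | 0 ≤ z.1 ∧ z.1 ≤ P.cE} := by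
  refine closure_minimal ?_ ((isClosed_le continuous_const continuous_fst).inter
    (isClosed_le continuous_fst continuous_const))
  rintro z ((hz | hz) | ⟨hθE, hθF, hs, hl⟩)
  · exact ⟨hz.1.le, hz.2.1.le⟩
  · exact ⟨hz.1.le, (hz.2.1.trans P.cA_lt_cE).le⟩
  · have hθ : z.2 ∈ Icc P.θE P.θF := ⟨hθE.le, hθF.le⟩
    have hsol := P.strictAntiOn_γs hθ P.θF_mem hθF
    rw [P.γs_θF] at hsol
    exact ⟨(hsol.trans hs).le, (hl.trans (P.strictAntiOn_γl P.θE_mem hθ hθE)).le⟩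

theorem cl_of_neg {z : ℝ × ℝ} (hz : z.1 < 0) : P.cl z = 0 := by
  have hL : z ∉ P.zoneL := fun h => lt_asymm hz h.1
  have hS : z ∉ P.zoneS := fun h => lt_asymm hz h.1
  have hminus : z ∈ closure P.zoneMinus :=
    subset_closure ⟨hz, fun h => hz.not_ge (P.closure_zones_subset h).1⟩
  rw [cl, if_neg hL, if_neg hS, if_pos hminus]

theorem cl_of_cE_lt {z : ℝ × ℝ} (hz : P.cE < z.1) : P.cl z = P.cE := by
  have hpos := P.cE_pos.trans hz
  have hL : z ∉ P.zoneL := fun h => lt_asymm hz h.2.1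
  have hS : z ∉ P.zoneS := fun h => lt_asymm hz (h.2.1.trans P.cA_lt_cE)
  have hsub : closure P.zoneMinus ⊆ {z | z.1 ≤ 0} :=
    closure_minimal (fun w hw => show w.1 ≤ 0 from le_of_lt hw.1)
      (isClosed_le continuous_fst continuous_const)
  have hminus : z ∉ closure P.zoneMinus := fun h => hpos.not_ge (hsub h)
  have hplus : z ∈ closure P.zonePlus :=
    subset_closure ⟨hpos, fun h => hz.not_ge (P.closure_zones_subset h).2⟩
  rw [cl, if_neg hL, if_neg hS, if_neg hminus, if_pos hplus]

end PhaseDiagram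

/-! ### Maximum principles for weak reproductive solutions -/

theorem ae_coe_le_of_forall_le {α : Type*} [MeasurableSpace α] {μ : Measure α} {w : α → ℝ}
    {b : EReal} (h : ∀ M : ℝ, b ≤ M → ∀ᵐ p ∂μ, w p ≤ M) : ∀ᵐ p ∂μ, (w p : EReal) ≤ b := by
  have hsup : essSup (fun p => (w p : EReal)) μ ≤ b :=
    EReal.le_of_forall_lt_iff_le.1 fun M hM =>
      essSup_le_of_ae_le _ ((h M hM.le).mono fun p hp => EReal.coe_le_coe_iff.2 hp)
  filter_upwards [ae_le_essSup (f := fun p => (w p : EReal)) (μ := μ)] with p hp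
  exact hp.trans hsup

theorem ae_le_coe_of_forall_le {α : Type*} [MeasurableSpace α] {μ : Measure α} {w : α → ℝ}
    {b : EReal} (h : ∀ M : ℝ, M ≤ b → ∀ᵐ p ∂μ, M ≤ w p) : ∀ᵐ p ∂μ, b ≤ (w p : EReal) := by
  have hinf : b ≤ essInf (fun p => (w p : EReal)) μ :=
    EReal.ge_of_forall_gt_iff_ge.1 fun M hM =>
      le_essInf_of_ae_le _ ((h M hM.le).mono fun p hp => EReal.coe_le_coe_iff.2 hp)
  filter_upwards [ae_essInf_le (f := fun p => (w p : EReal)) (μ := μ)] with p hp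
  exact hinf.trans hp

namespace Data

variable (D : Data)

instance : IsFiniteMeasure (volume.restrict D.Ω) :=
  ⟨by simpa using D.isBounded.measure_lt_top⟩

instance : IsFiniteMeasure (surf.restrict (frontier D.Ω)) :=
  ⟨by simpa using surf_frontier_lt_top D.isOpen D.isBounded D.boundary_C2⟩

theorem volume_pos : 0 < volume D.Ω := D.isOpen.measure_pos volume ⟨0, D.zero_mem⟩

variable {D}

theorem ae_le_of_θsup_le {θ₀ : E3 → ℝ} {M : ℝ} (hM : D.θsup θ₀ ≤ M) :
    ∀ᵐ x ∂volume.restrict D.Ω, θ₀ x ≤ M := by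
  filter_upwards [ae_le_essSup (f := fun x => (θ₀ x : EReal)) (μ := volume.restrict D.Ω)]
    with x hx
  exact EReal.coe_le_coe_iff.1 (hx.trans ((le_max_left _ _).trans hM))

theorem ae_θδ_le_of_θsup_le {θ₀ : E3 → ℝ} {M : ℝ} (hM : D.θsup θ₀ ≤ M) :
    ∀ᵐ t ∂volume.restrict (Ioo 0 D.T), ∀ᵐ x ∂surf.restrict D.Γbt, D.θδ t x ≤ M := by
  filter_upwards [ae_le_essSup (f := fun t => essSup (fun x => (D.θδ t x : EReal))
    (surf.restrict (D.Γb ∪ D.Γt))) (μ := volume.restrict (Ioo 0 D.T))] with t ht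
  filter_upwards [ae_le_essSup (f := fun x => (D.θδ t x : EReal))
    (μ := surf.restrict (D.Γb ∪ D.Γt))] with x hx
  exact EReal.coe_le_coe_iff.1 (hx.trans (ht.trans ((le_max_right _ _).trans hM)))

theorem ae_ge_of_le_θinf {θ₀ : E3 → ℝ} {M : ℝ} (hM : M ≤ D.θinf θ₀) :
    ∀ᵐ x ∂volume.restrict D.Ω, M ≤ θ₀ x := by
  filter_upwards [ae_essInf_le (f := fun x => (θ₀ x : EReal)) (μ := volume.restrict D.Ω)]
    with x hx
  exact EReal.coe_le_coe_iff.1 ((hM.trans (min_le_left _ _)).trans hx)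

theorem ae_θδ_ge_of_le_θinf {θ₀ : E3 → ℝ} {M : ℝ} (hM : M ≤ D.θinf θ₀) :
    ∀ᵐ t ∂volume.restrict (Ioo 0 D.T), ∀ᵐ x ∂surf.restrict D.Γbt, M ≤ D.θδ t x := by
  filter_upwards [ae_essInf_le (f := fun t => essInf (fun x => (D.θδ t x : EReal))
    (surf.restrict (D.Γb ∪ D.Γt))) (μ := volume.restrict (Ioo 0 D.T))] with t ht
  filter_upwards [ae_essInf_le (f := fun x => (D.θδ t x : EReal))
    (μ := surf.restrict (D.Γb ∪ D.Γt))] with x hx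
  exact EReal.coe_le_coe_iff.1 (((hM.trans (min_le_right _ _)).trans ht).trans hx)

end Data

namespace IsWeakReproductiveSolutionWith

variable {D : Data} {c θ : ℝ → E3 → ℝ} {v : ℝ → E3 → E3} {c₀ θ₀ : E3 → ℝ} {v₀ : E3 → E3}
  {Dc Dθ : ℝ → E3 → E3} {Dv : ℝ → Fin 3 → E3 → E3} {Dcl : ℝ → E3 → E3} {Φ : ℝ → ℝ}

theorem concentration_solvesTruncated
    (h : IsWeakReproductiveSolutionWith D c θ v c₀ θ₀ v₀ Dc Dθ Dv Dcl) (hΦ : IsTruncation Φ) :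
    SolvesTruncated D.Ω D.T D.η c Dc (fun t x => inner ℝ (v t x) (Dcl t x)) Φ := by
  refine .of_timeTest D.T_pos hΦ h.c_mem h.c_cont
    (integrable_inner_of_memLp h.v_memLp h.cl_mem.memLp_grad) ?_
  obtain ⟨C, hC⟩ := hΦ.lipschitz_deriv
  filter_upwards [h.c_mem.isH1] with t ht
  exact h.eq_c _ _ (ht.comp_lipschitz D.isOpen hΦ.contDiff_deriv hC)

theorem concentration_transport_eq_zero
    (h : IsWeakReproductiveSolutionWith D c θ v c₀ θ₀ v₀ Dc Dθ Dv Dcl) (hΦ : IsTruncation Φ) {k : ℝ}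
    (hcl : ∀ z : ℝ × ℝ, deriv Φ z.1 ≠ 0 → D.P.cl z = k) :
    ∫ p, inner ℝ (v p.1 p.2) (Dcl p.1 p.2) * deriv Φ (c p.1 p.2) ∂cylinder D.Ω D.T = 0 := by
  have hsol := h.concentration_solvesTruncated hΦ
  refine integral_eq_zero_of_ae (ae_prod_eq_zero_of_ae_ae
    (hsol.integrable_source.aestronglyMeasurable.mul
      (hsol.memLp_deriv_comp hΦ).aestronglyMeasurable) ?_)
  filter_upwards [h.cl_mem.isH1] with t ht
  filter_upwards [ht.grad_eq_zero_of_eq D.isOpen k] with x hx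
  by_cases hzero : deriv Φ (c t x) = 0
  · simp [hzero]
  · simp [hx (hcl (c t x, θ t x) hzero)]

theorem deriv_comp_concentration_eq_zero
    (h : IsWeakReproductiveSolutionWith D c θ v c₀ θ₀ v₀ Dc Dθ Dv Dcl) (hΦ : IsTruncation Φ) {k : ℝ}
    (hcl : ∀ z : ℝ × ℝ, deriv Φ z.1 ≠ 0 → D.P.cl z = k)
    (hmass : ∀ᵐ t ∂volume.restrict (Ioo 0 D.T), ∃ᵐ x ∂volume.restrict D.Ω, deriv Φ (c t x) = 0) :
    ∀ᵐ p ∂D.Q, deriv Φ (c p.1 p.2) = 0 := by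
  have hsol := h.concentration_solvesTruncated hΦ
  have hperiodic : ∫ x in D.Ω, Φ (c 0 x) = ∫ x in D.Ω, Φ (c D.T x) :=
    integral_congr_ae (h.c_periodic.mono fun x hx => congrArg Φ hx)
  refine ae_prod_eq_zero_of_ae_ae (w := fun p : ℝ × E3 => deriv Φ (c p.1 p.2))
    (hsol.memLp_deriv_comp hΦ).aestronglyMeasurable ?_
  filter_upwards [hsol.exists_deriv_comp_ae_eq_const D.isOpen D.isConnected D.T_pos D.η_pos hΦ
    hperiodic.le (h.concentration_transport_eq_zero hΦ hcl).ge, hmass] with t ⟨a, ha⟩ hzero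
  obtain ⟨x, hx, hxa⟩ := (hzero.and_eventually ha).exists
  exact ha.mono fun y hy => hy.trans (hxa.symm.trans hx)

theorem average_concentration_mem
    (h : IsWeakReproductiveSolutionWith D c θ v c₀ θ₀ v₀ Dc Dθ Dv Dcl) :
    ∀ᵐ t ∂volume.restrict (Ioo 0 D.T), (⨍ x in D.Ω, c t x) ∈ Icc 0 D.P.cE := by
  have hpos : 0 < volume.real D.Ω :=
    ENNReal.toReal_pos D.volume_pos.ne' D.isBounded.measure_lt_top.ne
  filter_upwards [h.mass] with t ht
  rw [setAverage_eq, ht, smul_eq_mul, inv_mul_eq_div]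
  exact ⟨div_nonneg D.cg_nonneg hpos.le, (div_le_iff₀ hpos).2 D.cg_le⟩

theorem concentration_le (h : IsWeakReproductiveSolutionWith D c θ v c₀ θ₀ v₀ Dc Dθ Dv Dcl) :
    ∀ᵐ p ∂D.Q, c p.1 p.2 ≤ D.P.γl D.P.θE := by
  have hderiv : ∀ s, deriv (fun s => smoothPosPart (s - D.P.cE)) s = 0 ↔ s ≤ D.P.cE := fun s => by
    rw [deriv_comp_sub_const, deriv_smoothPosPart, Real.smoothTransition.zero_iff_nonpos,
      sub_nonpos]
  have hzero := h.deriv_comp_concentration_eq_zero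
    (isTruncation_smoothPosPart.comp_sub_const D.P.cE) (k := D.P.cE)
    (fun z hz => D.P.cl_of_cE_lt (not_le.1 fun hle => hz ((hderiv _).2 hle))) ?_
  · exact hzero.mono fun p hp => (hderiv _).1 hp
  · filter_upwards [h.average_concentration_mem, h.c_mem.isH1] with t ht htH
    refine frequently_ae_iff.2 (ne_of_gt ?_)
    refine (measure_le_average_pos ?_ htH.integrableOn).trans_le (measure_mono fun x hx => ?_)
    · exact Measure.restrict_eq_zero.not.2 D.volume_pos.ne'
    · exact (hderiv _).2 (le_trans hx ht.2)

theorem concentration_nonneg (h : IsWeakReproductiveSolutionWith D c θ v c₀ θ₀ v₀ Dc Dθ Dv Dcl) :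
    ∀ᵐ p ∂D.Q, 0 ≤ c p.1 p.2 := by
  have hderiv : ∀ s, deriv (fun s => smoothPosPart (0 - s)) s = 0 ↔ 0 ≤ s := fun s => by
    rw [deriv_comp_const_sub, neg_eq_zero, deriv_smoothPosPart,
      Real.smoothTransition.zero_iff_nonpos, sub_nonpos]
  have hzero := h.deriv_comp_concentration_eq_zero (isTruncation_smoothPosPart.comp_const_sub 0)
    (k := 0) (fun z hz => D.P.cl_of_neg (not_le.1 fun hle => hz ((hderiv _).2 hle))) ?_
  · exact hzero.mono fun p hp => (hderiv _).1 hp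
  · filter_upwards [h.average_concentration_mem, h.c_mem.isH1] with t ht htH
    refine frequently_ae_iff.2 (ne_of_gt ?_)
    refine (measure_average_le_pos ?_ htH.integrableOn).trans_le (measure_mono fun x hx => ?_)
    · exact Measure.restrict_eq_zero.not.2 D.volume_pos.ne'
    · exact (hderiv _).2 (le_trans ht.1 hx)

theorem memHtheta_deriv_comp_temperature
    (h : IsWeakReproductiveSolutionWith D c θ v c₀ θ₀ v₀ Dc Dθ Dv Dcl) (hΦ : IsTruncation Φ)
    (hboundary : ∀ᵐ t ∂volume.restrict (Ioo 0 D.T), ∀ᵐ x ∂surf.restrict D.Γbt,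
      deriv Φ (D.θδ t x) = 0) :
    ∀ᵐ t ∂volume.restrict (Ioo 0 D.T), MemHtheta D.Ω D.Γbt (fun x => deriv Φ (θ t x))
      (fun x => deriv (deriv Φ) (θ t x) • Dθ t x) := by
  obtain ⟨C, hC⟩ := hΦ.lipschitz_deriv
  filter_upwards [h.θ_boundary, D.ext_trace, hboundary]
    with t ⟨τ₁, htrace₁, hτ₁⟩ ⟨τ₂, htrace₂, hτ₂⟩ hzero
  have htrace := htrace₁.add htrace₂
  simp only [sub_add_cancel] at htrace
  refine ⟨_, htrace.comp_lipschitz D.isOpen hΦ.contDiff_deriv hC, ?_⟩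
  filter_upwards [hτ₁, hτ₂, hzero] with x hx₁ hx₂ hx
  rw [hx₁, hx₂, zero_add, hx]

theorem temperature_solvesTruncated
    (h : IsWeakReproductiveSolutionWith D c θ v c₀ θ₀ v₀ Dc Dθ Dv Dcl) (hΦ : IsTruncation Φ)
    (hboundary : ∀ᵐ t ∂volume.restrict (Ioo 0 D.T), ∀ᵐ x ∂surf.restrict D.Γbt,
      deriv Φ (D.θδ t x) = 0) :
    SolvesTruncated D.Ω D.T D.κ θ Dθ (fun t x => D.ρ * D.Cp * inner ℝ (v t x) (Dθ t x)) Φ := by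
  refine .of_timeTest D.T_pos hΦ h.θ_mem h.θ_cont
    ((integrable_inner_of_memLp h.v_memLp h.θ_mem.memLp_grad).const_mul _) ?_
  filter_upwards [h.memHtheta_deriv_comp_temperature hΦ hboundary] with t ht
  simpa only [mul_assoc _ (inner ℝ _ _) (_), integral_const_mul] using h.eq_θ _ _ ht

theorem temperature_transport_eq_zero
    (h : IsWeakReproductiveSolutionWith D c θ v c₀ θ₀ v₀ Dc Dθ Dv Dcl) (hΦ : IsTruncation Φ)
    {t : ℝ} (ht : t ≤ D.T) :
    ∫ p, D.ρ * D.Cp * inner ℝ (v p.1 p.2) (Dθ p.1 p.2) * deriv Φ (θ p.1 p.2) ∂cylinder D.Ω t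
      = 0 := by
  have hint : Integrable (fun p : ℝ × E3 => D.ρ * D.Cp * inner ℝ (v p.1 p.2) (Dθ p.1 p.2)
      * deriv Φ (θ p.1 p.2)) (cylinder D.Ω D.T) :=
    ((integrable_inner_of_memLp h.v_memLp h.θ_mem.memLp_grad).const_mul _).mul_bdd (c := 1)
      (hΦ.contDiff_deriv.continuous.comp_aestronglyMeasurable h.θ_mem.memLp.aestronglyMeasurable)
      (.of_forall fun _ => hΦ.abs_deriv_le_one _)
  rw [cylinder, integral_prod _ (hint.mono_measure (cylinder_mono D.Ω ht))]
  refine integral_eq_zero_of_ae ?_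
  filter_upwards [ae_restrict_of_ae_restrict_of_subset (Ioo_subset_Ioo_right ht) h.θ_mem.isH1,
    ae_restrict_of_ae_restrict_of_subset (Ioo_subset_Ioo_right ht) h.v_memH] with s hs hvs
  have hnormal := hvs.normal_eq_zero _ _
    (hs.comp_lipschitz D.isOpen (hΦ.contDiff.of_le one_le_two) hΦ.lipschitz)
  simp only [real_inner_smul_right] at hnormal
  simp only [mul_assoc _ (inner ℝ _ _) (_), integral_const_mul, mul_comm (inner ℝ _ _), hnormal,
    mul_zero, Pi.zero_apply]

theorem truncation_temperature_eq_zero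
    (h : IsWeakReproductiveSolutionWith D c θ v c₀ θ₀ v₀ Dc Dθ Dv Dcl) (hΦ : IsTruncation Φ)
    (hnonneg : ∀ s, 0 ≤ Φ s) (hinit : ∀ᵐ x ∂volume.restrict D.Ω, Φ (θ₀ x) = 0)
    (hboundary : ∀ᵐ t ∂volume.restrict (Ioo 0 D.T), ∀ᵐ x ∂surf.restrict D.Γbt,
      deriv Φ (D.θδ t x) = 0) :
    ∀ᵐ p ∂D.Q, Φ (θ p.1 p.2) = 0 := by
  refine (h.temperature_solvesTruncated hΦ hboundary).ae_comp_eq_zero D.isOpen.measurableSet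
    D.κ_pos.le hΦ hnonneg ?_ fun t ht => (h.temperature_transport_eq_zero hΦ ht.2.le).ge
  filter_upwards [h.θ_periodic, h.θ_T, hinit] with x hx hxT hx₀
  rw [hx, hxT, hx₀]

theorem temperature_le (h : IsWeakReproductiveSolutionWith D c θ v c₀ θ₀ v₀ Dc Dθ Dv Dcl) :
    ∀ᵐ p ∂D.Q, (θ p.1 p.2 : EReal) ≤ D.θsup θ₀ := by
  refine ae_coe_le_of_forall_le fun M hM => ?_
  have hzero := h.truncation_temperature_eq_zero (isTruncation_smoothPosPart.comp_sub_const M)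
    (fun _ => smoothPosPart_nonneg _)
    ((Data.ae_le_of_θsup_le hM).mono fun x hx => smoothPosPart_eq_zero (sub_nonpos.2 hx))
    ((Data.ae_θδ_le_of_θsup_le hM).mono fun t ht => ht.mono fun x hx => by
      rw [deriv_comp_sub_const, deriv_smoothPosPart]
      exact Real.smoothTransition.zero_of_nonpos (sub_nonpos.2 hx))
  exact hzero.mono fun p hp => sub_nonpos.1 (smoothPosPart_eq_zero_iff.1 hp)

theorem le_temperature (h : IsWeakReproductiveSolutionWith D c θ v c₀ θ₀ v₀ Dc Dθ Dv Dcl) :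
    ∀ᵐ p ∂D.Q, D.θinf θ₀ ≤ (θ p.1 p.2 : EReal) := by
  refine ae_le_coe_of_forall_le fun M hM => ?_
  have hzero := h.truncation_temperature_eq_zero (isTruncation_smoothPosPart.comp_const_sub M)
    (fun _ => smoothPosPart_nonneg _)
    ((Data.ae_ge_of_le_θinf hM).mono fun x hx => smoothPosPart_eq_zero (sub_nonpos.2 hx))
    ((Data.ae_θδ_ge_of_le_θinf hM).mono fun t ht => ht.mono fun x hx => by
      rw [deriv_comp_const_sub, deriv_smoothPosPart, neg_eq_zero]
      exact Real.smoothTransition.zero_of_nonpos (sub_nonpos.2 hx))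
  exact hzero.mono fun p hp => sub_nonpos.1 (smoothPosPart_eq_zero_iff.1 hp)

end IsWeakReproductiveSolutionWith

end

end Solidification

theorem proposition3p5 (D : Solidification.Data)
    (c θ : ℝ → Solidification.E3 → ℝ) (v : ℝ → Solidification.E3 → Solidification.E3)
    (c₀ θ₀ : Solidification.E3 → ℝ) (v₀ : Solidification.E3 → Solidification.E3)
    (h : Solidification.IsWeakReproductiveSolution D c θ v c₀ θ₀ v₀) :
    (∀ᵐ p ∂D.Q, 0 ≤ c p.1 p.2 ∧ c p.1 p.2 ≤ D.P.γl D.P.θE) ∧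
    (∀ᵐ p ∂D.Q, D.θinf θ₀ ≤ (θ p.1 p.2 : EReal) ∧ (θ p.1 p.2 : EReal) ≤ D.θsup θ₀) := by
  obtain ⟨Dc, Dθ, Dv, Dcl, h⟩ := h
  exact ⟨h.concentration_nonneg.and h.concentration_le, h.le_temperature.and h.temperature_le⟩
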